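/- **Setting.** Let $\mathcal A$ be a unital complex $*$-algebra with two states (positive unital linear functionals) $\varphi,\psi$. The free cumulants $r_n$ of $\psi$ and the two-state free cumulants $R_n$ of $(\varphi,\psi)$ are the multilinear functionals determined by $$\psi(a_1\cdots a_n)=\sum_{\pi\in NC(n)}\prod_{V\in\pi} r_{|V|}(a_i: i\in V),\qquad \varphi(a_1\cdots a_n)=\sum_{\pi\in NC(n)}\ \prod_{V\ \mathrm{outer}} R_{|V|}(a_i:i\in V)\prod_{U\ \mathrm{inner}} r_{|U|}(a_i:i\in U),$$ where $NC(n)$ is the set of noncrossing partitions of $\{1,\dots,n\}$, and a block is inner if it is nested in another block and outer otherwise. Elements $X,Y$ are $(\varphi|\psi)$-free if all their mixed two-state free cumulants vanish, and $\psi$-free if all their mixed free cumulants with respect to $\psi$ vanish. A self-adjoint element $x$ has distribution $(\widetilde\nu,\nu)$ if $\widetilde\nu,\nu$ are probability measures on $\mathbb R$ with all moments finite and $\varphi(x^n)=\int t^n\,d\widetilde\nu$, $\psi(x^n)=\int t^n\,d\nu$ for all $n\ge 0$. A probability measure $\nu$ with all moments finite has Jacobi parameters $J(\nu)=\begin{pmatrix}\beta_0,&\beta_1,&\dots\\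 \gamma_0,&\gamma_1,&\dots\end{pmatrix}$ ($\beta_n\in\mathbb R$, $\gamma_n\ge 0$) if the monic polynomials with $P_0=1$, $P_{-1}=0$, $xP_m=P_{m+1}+\beta_mP_m+\gamma_{m-1}P_{m-1}$ are orthogonal with respect to $\nu$; terms after the first $\gamma_m=0$ are disregarded. A free Meixner distribution is a probability measure with Jacobi parameters $\begin{pmatrix}\beta_0,&b'+\beta_0,&b'+\beta_0,&\dots\\ \gamma_0,&c'+\gamma_0,&c'+\gamma_0,&\dots\end{pmatrix}$, where $\gamma_0\ge 0$, $c'+\gamma_0\ge0$. A two-state free Meixner distribution is a pair $(\widetilde\nu,\nu)$ of probability measures with, for some real parameters satisfying $\gamma_0>0$, $\widetilde\gamma_0\ge0$, $c'+\gamma_0\ge0$, $\widetilde c+\gamma_0\ge0$, $$J(\widetilde\nu)=\begin{pmatrix}\widetilde\beta_0,&\widetilde b+\beta_0,&b'+\beta_0,&b'+\beta_0,&\dots\\ \widetilde\gamma_0,&\widetilde c+\gamma_0,&c'+\gamma_0,&c'+\gamma_0,&\dots\end{pmatrix},\qquad J(\nu)=\begin{pmatrix}\beta_0,&b'+\beta_0,&b'+\beta_0,&\dots\\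 \gamma_0,&c'+\gamma_0,&c'+\gamma_0,&\dots\end{pmatrix}.$$ **Proposition.** Let $X,Y\in\mathcal A$ be self-adjoint and $(\varphi|\psi)$-free, with $\varphi(X^n)=\varphi(Y^n)$ and $\psi(X^n)=\psi(Y^n)$ for all $n$, $\varphi(X)=0$ and $\varphi(X^2)=1$. Put $S=X+Y$ and suppose that there are $b,C\in\mathbb R$ and $c>-2$ with $$\varphi\big[(X-Y)^2S^n\big]=C\,\varphi\big[(4+2bS+cS^2)S^n\big],\qquad n=0,1,2,\dots$$ 1. If $S$ has distribution $(\widetilde\mu_S,\mu_S)$ and $\mu_S$ has Jacobi parameters $\beta_n(\mu_S),\gamma_n(\mu_S)$, then $$J(\widetilde\mu_S)=\begin{pmatrix}0,&b+(1+c/2)\beta_0(\mu_S),&\beta_1(\mu_S),&\beta_2(\mu_S),&\dots\\ 2,&(1+c/2)\gamma_0(\mu_S),&\gamma_1(\mu_S),&\gamma_2(\mu_S),&\dots\end{pmatrix}.$$ 2. Suppose in addition that $X,Y$ are $\psi$-free, that $c\ge-1$, and that $X$ has distribution $(\widetilde\mu,\mu)$, where $\mu$ is a free Meixner distribution with parameters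 $\beta_0,\gamma_0,b',c'$ as above (for example, but not necessarily, $b'=b$ and $c'=c$). Then $$J(\widetilde\mu)=\begin{pmatrix}0,&(b+c\beta_0)+\beta_0,&b'+\beta_0,&b'+\beta_0,&\dots\\ 1,&c\gamma_0+\gamma_0,&c'+\gamma_0,&c'+\gamma_0,&\dots\end{pmatrix}.$$ If moreover $\gamma_0>0$ (that is, $\mu$ is not a point mass), then $(\widetilde\mu,\mu)$ is a two-state free Meixner distribution. -/

import Mathlib

open scoped ComplexOrder

/-! ### Two-state non-commutative probability spaces -/

/-- A state on a unital complex `*`-algebra: a positive unital linear functional. -/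
structure IsState {A : Type*} [Ring A] [StarRing A] [Algebra ℂ A] (φ : A →ₗ[ℂ] ℂ) : Prop where
  map_one : φ 1 = 1
  nonneg : ∀ a : A, 0 ≤ φ (star a * a)

/-- `x` has the distribution `(μt, μ)` in `(A, φ, ψ)`: these are probability measures on `ℝ` with
finite moments of all orders, whose moments are those of `x` under `φ` and under `ψ`. -/
structure HasTwoStateDistribution {A : Type*} [Ring A] [Algebra ℂ A] (φ ψ : A →ₗ[ℂ] ℂ) (x : A)
    (μt μ : MeasureTheory.Measure ℝ) : Prop where
  isProbabilityMeasure_left : MeasureTheory.IsProbabilityMeasure μt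
  isProbabilityMeasure_right : MeasureTheory.IsProbabilityMeasure μ
  integrable_left : ∀ n : ℕ, MeasureTheory.Integrable (fun t : ℝ => t ^ n) μt
  integrable_right : ∀ n : ℕ, MeasureTheory.Integrable (fun t : ℝ => t ^ n) μ
  moment_left : ∀ n : ℕ, φ (x ^ n) = ((∫ t, t ^ n ∂μt : ℝ) : ℂ)
  moment_right : ∀ n : ℕ, ψ (x ^ n) = ((∫ t, t ^ n ∂μ : ℝ) : ℂ)

/-! ### Noncrossing partitions -/

/-- A partition `π` of a finite set of natural numbers is noncrossing if
`x₁ < x₂ < x₃ < x₄` with `x₁, x₃ ∈ V`, `x₂, x₄ ∈ W` is possible only for `V = W`. -/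
def IsNoncrossing {s : Finset ℕ} (π : Finpartition s) : Prop :=
  ∀ V ∈ π.parts, ∀ W ∈ π.parts, ∀ x₁ ∈ V, ∀ x₂ ∈ W, ∀ x₃ ∈ V, ∀ x₄ ∈ W,
    x₁ < x₂ → x₂ < x₃ → x₃ < x₄ → V = W

/-- A block `V` of `π` is inner if it is nested in another block `W` of `π`, that is,
`p ≤ k ≤ q` for all `k ∈ V`, for some `p, q ∈ W`.  The other blocks are outer. -/
def IsInnerBlock {s : Finset ℕ} (π : Finpartition s) (V : Finset ℕ) : Prop :=
  ∃ W ∈ π.parts, W ≠ V ∧ ∃ p ∈ W, ∃ q ∈ W, ∀ k ∈ V, p ≤ k ∧ k ≤ q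

open Classical in
/-- The noncrossing partitions of `s`. -/
noncomputable def noncrossingPartitions (s : Finset ℕ) : Finset (Finpartition s) :=
  Finset.univ.filter fun π => IsNoncrossing π

/-- A block of a partition other than the one-block partition is smaller than the whole set. -/
theorem card_block_lt {s : Finset ℕ} {π : Finpartition s} (hπ : s ∉ π.parts) {V : Finset ℕ}
    (hV : V ∈ π.parts) : V.card < s.card := by
  refine Finset.card_lt_card ((π.le hV).lt_of_ne ?_)
  rintro rfl
  exact hπ hV

/-! ### Free and two-state free cumulants -/

section Cumulants

variable {A : Type*} [Ring A] [Algebra ℂ A]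

/-- The mixed moment `φ (a i₁ ⋯ a iₖ)`, where `s = {i₁ < ⋯ < iₖ}`. -/
noncomputable def jointMoment (φ : A →ₗ[ℂ] ℂ) (a : ℕ → A) (s : Finset ℕ) : ℂ :=
  φ ((s.sort (· ≤ ·)).map a).prod

open Classical in
/-- The free cumulant `r_k (a i₁, …, a iₖ)` with respect to `ψ`, where `s = {i₁ < ⋯ < iₖ}`. It is
the unique solution of the moment-cumulant formula (`jointMoment_eq_sum_freeCumulant`), solved for
the term of the one-block partition `{s}`. -/
noncomputable def freeCumulant (ψ : A →ₗ[ℂ] ℂ) (a : ℕ → A) (s : Finset ℕ) : ℂ :=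
  jointMoment ψ a s -
    ∑ π ∈ ((noncrossingPartitions s).filter fun π => s ∉ π.parts).attach,
      ∏ V ∈ π.1.parts.attach, freeCumulant ψ a V.1
termination_by s.card
decreasing_by exact card_block_lt (Finset.mem_filter.1 π.2).2 V.2

open Classical in
/-- The two-state free (conditionally free) cumulant `R_k (a i₁, …, a iₖ)` with respect to `(φ, ψ)`,
where `s = {i₁ < ⋯ < iₖ}`. It is the unique solution of the moment-cumulant formula
(`jointMoment_eq_sum_twoStateCumulant`), solved for the term of the one-block partition `{s}`. -/
noncomputable def twoStateCumulant (φ ψ : A →ₗ[ℂ] ℂ) (a : ℕ → A) (s : Finset ℕ) : ℂ :=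
  jointMoment φ a s -
    ∑ π ∈ ((noncrossingPartitions s).filter fun π => s ∉ π.parts).attach,
      ∏ V ∈ π.1.parts.attach,
        if IsInnerBlock π.1 V.1 then freeCumulant ψ a V.1 else twoStateCumulant φ ψ a V.1
termination_by s.card
decreasing_by exact card_block_lt (Finset.mem_filter.1 π.2).2 V.2

/-- Two self-adjoint elements are `(φ | ψ)`-free: all their mixed two-state free cumulants
vanish. The word is `a i = X` or `a i = Y` according to `ε i`. -/
def IsTwoStateFree (φ ψ : A →ₗ[ℂ] ℂ) (X Y : A) : Prop :=
  ∀ (ε : ℕ → Bool) (s : Finset ℕ), (∃ i ∈ s, ∃ j ∈ s, ε i ≠ ε j) →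
    twoStateCumulant φ ψ (fun i => if ε i then X else Y) s = 0

/-- Two elements are free with respect to `ψ`: all their mixed free cumulants vanish. -/
def IsFreePair (ψ : A →ₗ[ℂ] ℂ) (X Y : A) : Prop :=
  ∀ (ε : ℕ → Bool) (s : Finset ℕ), (∃ i ∈ s, ∃ j ∈ s, ε i ≠ ε j) →
    freeCumulant ψ (fun i => if ε i then X else Y) s = 0

end Cumulants

/-- The only partition with `s` among its blocks is the one-block partition. -/
theorem parts_eq_of_mem {s : Finset ℕ} {π : Finpartition s} (h : s ∈ π.parts) :
    π.parts = {s} := by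
  refine Finset.eq_singleton_iff_unique_mem.2 ⟨h, fun V hV => ?_⟩
  by_contra hne
  have hd := π.disjoint hV h hne
  exact π.ne_bot hV (disjoint_self.1 (hd.mono_right (π.le hV)))

open Classical in
/-- The sum over all noncrossing partitions, with the one-block partition split off. -/
theorem sum_noncrossing_eq {s : Finset ℕ} (hs : s.Nonempty) (f : Finpartition s → ℂ) :
    ∑ π ∈ noncrossingPartitions s, f π =
      f (Finpartition.indiscrete hs.ne_empty) +
        ∑ π ∈ (noncrossingPartitions s).filter fun π => s ∉ π.parts, f π := by
  rw [← Finset.sum_filter_add_sum_filter_not (noncrossingPartitions s) (fun π => s ∈ π.parts)]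
  congr 1
  have : (noncrossingPartitions s).filter (fun π => s ∈ π.parts) =
      {Finpartition.indiscrete hs.ne_empty} := by
    ext π
    simp only [noncrossingPartitions, Finset.mem_filter, Finset.mem_univ, true_and,
      Finset.mem_singleton]
    constructor
    · rintro ⟨-, h⟩
      exact Finpartition.ext (parts_eq_of_mem h)
    · rintro rfl
      refine ⟨?_, by simp⟩
      intro V hV W hW
      simp only [Finpartition.indiscrete_parts, Finset.mem_singleton] at hV hW
      intros
      rw [hV, hW]
  rw [this, Finset.sum_singleton]

open Classical in
/-- The free moment-cumulant formula. -/
theorem jointMoment_eq_sum_freeCumulant {A : Type*} [Ring A] [Algebra ℂ A] (ψ : A →ₗ[ℂ] ℂ)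
    (a : ℕ → A) {s : Finset ℕ} (hs : s.Nonempty) :
    jointMoment ψ a s =
      ∑ π ∈ noncrossingPartitions s, ∏ V ∈ π.parts, freeCumulant ψ a V := by
  rw [sum_noncrossing_eq hs, Finpartition.indiscrete_parts, Finset.prod_singleton]
  conv_rhs => enter [1]; rw [freeCumulant]
  rw [Finset.sum_attach _ (fun π : Finpartition s =>
    ∏ V ∈ π.parts.attach, freeCumulant ψ a V.1)]
  simp only [Finset.prod_attach _ (fun V => freeCumulant ψ a V)]
  ring

open Classical in
/-- The two-state free moment-cumulant formula. -/
theorem jointMoment_eq_sum_twoStateCumulant {A : Type*} [Ring A] [Algebra ℂ A]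
    (φ ψ : A →ₗ[ℂ] ℂ) (a : ℕ → A) {s : Finset ℕ} (hs : s.Nonempty) :
    jointMoment φ a s =
      ∑ π ∈ noncrossingPartitions s, ∏ V ∈ π.parts,
        if IsInnerBlock π V then freeCumulant ψ a V else twoStateCumulant φ ψ a V := by
  rw [sum_noncrossing_eq hs, Finpartition.indiscrete_parts, Finset.prod_singleton, if_neg]
  · conv_rhs => enter [1]; rw [twoStateCumulant]
    rw [Finset.sum_attach _ (fun π : Finpartition s => ∏ V ∈ π.parts.attach,
      if IsInnerBlock π V.1 then freeCumulant ψ a V.1 else twoStateCumulant φ ψ a V.1)]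
    have h : ∀ π : Finpartition s, (∏ V ∈ π.parts.attach,
        if IsInnerBlock π V.1 then freeCumulant ψ a V.1 else twoStateCumulant φ ψ a V.1) =
        ∏ V ∈ π.parts,
          if IsInnerBlock π V then freeCumulant ψ a V else twoStateCumulant φ ψ a V :=
      fun π => Finset.prod_attach _ (fun V =>
        if IsInnerBlock π V then freeCumulant ψ a V else twoStateCumulant φ ψ a V)
    simp only [h]
    ring
  · rintro ⟨W, hW, hne, -⟩
    exact hne (by simpa using hW)

/-! ### Jacobi parameters -/

/-- The monic polynomials with `P₀ = 1` and `x Pₘ = Pₘ₊₁ + βₘ Pₘ + γₘ₋₁ Pₘ₋₁`, `P₋₁ = 0`. -/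
noncomputable def jacobiPoly (β γ : ℕ → ℝ) : ℕ → Polynomial ℝ
  | 0 => 1
  | 1 => Polynomial.X - Polynomial.C (β 0)
  | n + 2 => (Polynomial.X - Polynomial.C (β (n + 1))) * jacobiPoly β γ (n + 1) -
      Polynomial.C (γ n) * jacobiPoly β γ n

/-- The measure `μ` on `ℝ`, with finite moments, has Jacobi parameters `(β, γ)`: the monic
polynomials given by the recurrence are orthogonal with respect to `μ`. Once `γₙ = 0`, the
polynomials `Pₘ` with `m > n` vanish `μ`-almost everywhere, whatever the later parameters are; so
the terms after the first vanishing `γₙ` are disregarded, as is the convention. -/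
structure HasJacobiParameters (μ : MeasureTheory.Measure ℝ) (β γ : ℕ → ℝ) : Prop where
  integrable : ∀ n : ℕ, MeasureTheory.Integrable (fun x : ℝ => x ^ n) μ
  nonneg : ∀ n : ℕ, 0 ≤ γ n
  orthogonal : ∀ m n : ℕ, m ≠ n →
    ∫ x, (jacobiPoly β γ m).eval x * (jacobiPoly β γ n).eval x ∂μ = 0

/-- The sequence `x, f 0, f 1, f 2, …`. -/
def consSeq (x : ℝ) (f : ℕ → ℝ) : ℕ → ℝ
  | 0 => x
  | n + 1 => f n

/-- `μ` is the free Meixner distribution with parameters `β₀, γ₀, b, c`. -/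
structure IsFreeMeixner (μ : MeasureTheory.Measure ℝ) (β₀ γ₀ b c : ℝ) : Prop where
  isProbabilityMeasure : MeasureTheory.IsProbabilityMeasure μ
  gamma_nonneg : 0 ≤ γ₀
  add_nonneg : 0 ≤ c + γ₀
  jacobi : HasJacobiParameters μ (consSeq β₀ fun _ => b + β₀) (consSeq γ₀ fun _ => c + γ₀)

/-- `(μt, μ)` is a two-state free Meixner distribution. -/
def IsTwoStateFreeMeixner (μt μ : MeasureTheory.Measure ℝ) : Prop :=
  MeasureTheory.IsProbabilityMeasure μt ∧ MeasureTheory.IsProbabilityMeasure μ ∧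
  ∃ βt₀ γt₀ bt ct β₀ γ₀ b c : ℝ,
    0 < γ₀ ∧ 0 ≤ γt₀ ∧ 0 ≤ c + γ₀ ∧ 0 ≤ ct + γ₀ ∧
    HasJacobiParameters μt (consSeq βt₀ (consSeq (bt + β₀) fun _ => b + β₀))
      (consSeq γt₀ (consSeq (ct + γ₀) fun _ => c + γ₀)) ∧
    HasJacobiParameters μ (consSeq β₀ fun _ => b + β₀) (consSeq γ₀ fun _ => c + γ₀)

/-! ### Weighted sums over noncrossing partitions -/

/-! Write `S = X + Y`, and let `M`, `m` be the moment series of `S` under `φ`, `ψ`. Because `X` and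
`Y` have the same moments, their cumulants agree, so a two-state cumulant of a word in `X - Y` and
`S` in which `X - Y` occurs once vanishes, and one in which it occurs twice equals that of `S`.
Hence `φ((X - Y)²Sⁿ)` is the part of the moment-cumulant sum for `φ(Sⁿ⁺²)` over partitions with the
first two points in one block (`ncSumOver_pair_eq`). Sorting all partitions by the second element of
the first block, which is not a singleton since `φ(S) = 0`, gives `φ(Sⁿ⁺²) = ∑ᵢ ψ(Sⁱ) φ((X -
Y)²Sⁿ⁻ⁱ)` (`map_add_pow_add_two`). Only outer blocks meet the letters `X - Y`, so `(φ|ψ)`-freeness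
suffices here.

Inserting the regression condition yields `(2 + c)(M - 1) = m(4z²M + (2bz + c)(M - 1))`
(`momentSeries_add_eq`). It is linear in `M`, with an invertible coefficient. The continued fraction
of `m` turns it into one for `M` with the same tail, which is the first claim
(`eq_jacobiSeries_of_sum_eq`).

For the second claim, the cumulant series `T` (two-state) and `t` (free) of `X` satisfy `M_X = 1 + z
M_X T(z m_X)` and `m_X = 1 + z m_X t(z m_X)`. With `ψ`-freeness added, those of `S` are `2T` and
`2t`. The equation for `S` then says that `T = z(1 + bT + c tT)` after substituting `z m` for `z`.
This substitution is injective, so the identity holds outright and can be evaluated at `z m_X`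
(`momentSeries_summand_eq`). The resulting equation for `X` is solved by a continued fraction in the
same way (`eq_jacobiSeries_of_summand_eq`).

Jacobi parameters enter only through moments: for a probability measure with finite moments and `γ ≥
0`, orthogonality is equivalent to the `n`-th moment being `jacobiCoeff β γ n 0`. Vanishing `γ` need
no separate treatment. -/

theorem block_unique {s : Finset ℕ} {π : Finpartition s} {V W : Finset ℕ} {x : ℕ}
    (hV : V ∈ π.parts) (hW : W ∈ π.parts) (hxV : x ∈ V) (hxW : x ∈ W) : V = W := by
  by_contra hne
  exact Finset.disjoint_left.1 (π.disjoint hV hW hne) hxV hxW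

theorem block_nonempty {s : Finset ℕ} {π : Finpartition s} {V : Finset ℕ}
    (hV : V ∈ π.parts) : V.Nonempty :=
  Finset.nonempty_iff_ne_empty.2 (π.ne_bot hV)

theorem mem_noncrossingPartitions {s : Finset ℕ} {π : Finpartition s} :
    π ∈ noncrossingPartitions s ↔ IsNoncrossing π := by
  simp [noncrossingPartitions]

/-- No element of `B` lies between two elements of `A`. -/
def IsGapOf (A B : Finset ℕ) : Prop :=
  ∀ b ∈ B, (∀ a ∈ A, b < a) ∨ ∀ a ∈ A, a < b

theorem IsGapOf.disjoint {A B : Finset ℕ} (h : IsGapOf A B) : Disjoint A B := by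
  rw [Finset.disjoint_left]
  intro x hA hB
  rcases h x hB with h | h
  · exact lt_irrefl _ (h x hA)
  · exact lt_irrefl _ (h x hA)

theorem exists_join {A B s : Finset ℕ} (hs : s = A ∪ B) (h : Disjoint A B)
    (πA : Finpartition A) (πB : Finpartition B) :
    ∃ π : Finpartition s, π.parts = πA.parts ∪ πB.parts := by
  subst hs
  refine ⟨Finpartition.ofExistsUnique (πA.parts ∪ πB.parts) ?_ ?_ ?_, rfl⟩
  · intro p hp
    rcases Finset.mem_union.1 hp with hp | hp
    · exact (πA.le hp).trans Finset.subset_union_left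
    · exact (πB.le hp).trans Finset.subset_union_right
  · intro a ha
    rcases Finset.mem_union.1 ha with ha | ha
    · obtain ⟨t, ht, hat⟩ := πA.exists_mem ha
      refine ⟨t, ⟨Finset.mem_union_left _ ht, hat⟩, ?_⟩
      rintro t' ⟨ht', hat'⟩
      rcases Finset.mem_union.1 ht' with ht' | ht'
      · exact block_unique ht' ht hat' hat
      · exact absurd (πB.le ht' hat') (Finset.disjoint_left.1 h ha)
    · obtain ⟨t, ht, hat⟩ := πB.exists_mem ha
      refine ⟨t, ⟨Finset.mem_union_right _ ht, hat⟩, ?_⟩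
      rintro t' ⟨ht', hat'⟩
      rcases Finset.mem_union.1 ht' with ht' | ht'
      · exact absurd ha (Finset.disjoint_left.1 h (πA.le ht' hat'))
      · exact block_unique ht' ht hat' hat
  · intro h0
    rcases Finset.mem_union.1 h0 with h0 | h0
    · exact πA.ne_bot h0 rfl
    · exact πB.ne_bot h0 rfl

theorem exists_restrict {A s : Finset ℕ} (hA : A ⊆ s) (π : Finpartition s)
    (h : ∀ V ∈ π.parts, V ⊆ A ∨ Disjoint V A) :
    ∃ πA : Finpartition A, ∀ V, V ∈ πA.parts ↔ V ∈ π.parts ∧ V ⊆ A := by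
  refine ⟨Finpartition.ofExistsUnique (π.parts.filter (· ⊆ A)) ?_ ?_ ?_, ?_⟩
  · intro p hp
    exact (Finset.mem_filter.1 hp).2
  · intro a ha
    obtain ⟨t, ht, hat⟩ := π.exists_mem (hA ha)
    refine ⟨t, ⟨Finset.mem_filter.2 ⟨ht, ?_⟩, hat⟩, ?_⟩
    · rcases h t ht with h | h
      · exact h
      · exact absurd ha (Finset.disjoint_left.1 h hat)
    · rintro t' ⟨ht', hat'⟩
      exact block_unique (Finset.mem_filter.1 ht').1 ht hat' hat
  · intro h0
    exact π.ne_bot (Finset.mem_filter.1 h0).1 rfl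
  · intro V
    exact Finset.mem_filter

/-- A crossing between a block in `A` and a block in `B` would put a point of `B` between two points
of `A`. -/
theorem isNoncrossing_join {A B s : Finset ℕ} (h : IsGapOf A B) {π : Finpartition s}
    {πA : Finpartition A} {πB : Finpartition B} (hπ : π.parts = πA.parts ∪ πB.parts) :
    IsNoncrossing π ↔ IsNoncrossing πA ∧ IsNoncrossing πB := by
  constructor
  · intro hn
    constructor
    · intro V hV W hW
      exact hn V (hπ ▸ Finset.mem_union_left _ hV) W (hπ ▸ Finset.mem_union_left _ hW)
    · intro V hV W hW
      exact hn V (hπ ▸ Finset.mem_union_right _ hV) W (hπ ▸ Finset.mem_union_right _ hW)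
  · rintro ⟨hA, hB⟩ V hV W hW x₁ h₁ x₂ h₂ x₃ h₃ x₄ h₄ h12 h23 h34
    rw [hπ, Finset.mem_union] at hV hW
    rcases hV with hV | hV <;> rcases hW with hW | hW
    · exact hA V hV W hW x₁ h₁ x₂ h₂ x₃ h₃ x₄ h₄ h12 h23 h34
    · have a1 := πA.le hV h₁
      have a3 := πA.le hV h₃
      rcases h x₂ (πB.le hW h₂) with h | h
      · have := h x₁ a1; omega
      · have := h x₃ a3; omega
    · have a1 := πA.le hW h₂
      have a3 := πA.le hW h₄
      rcases h x₃ (πB.le hV h₃) with h | h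
      · have := h x₂ a1; omega
      · have := h x₄ a3; omega
    · exact hB V hV W hW x₁ h₁ x₂ h₂ x₃ h₃ x₄ h₄ h12 h23 h34

/-- A block in `A` cannot surround a point of `B`. There is no counterpart for blocks in `A`: they
may become inner when a block in `B` surrounds them. -/
theorem isInnerBlock_join_right {A B s : Finset ℕ} (h : IsGapOf A B) {π : Finpartition s}
    {πA : Finpartition A} {πB : Finpartition B} (hπ : π.parts = πA.parts ∪ πB.parts)
    {V : Finset ℕ} (hV : V ∈ πB.parts) : IsInnerBlock π V ↔ IsInnerBlock πB V := by
  constructor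
  · rintro ⟨W, hW, hne, p, hp, q, hq, hk⟩
    rw [hπ, Finset.mem_union] at hW
    rcases hW with hW | hW
    · obtain ⟨k, hkV⟩ := block_nonempty hV
      have hd := Finset.disjoint_left.1 h.disjoint
      have := hk k hkV
      rcases h k (πB.le hV hkV) with h | h
      · have := h p (πA.le hW hp); omega
      · have := h q (πA.le hW hq); omega
    · exact ⟨W, hW, hne, p, hp, q, hq, hk⟩
  · rintro ⟨W, hW, hr⟩
    exact ⟨W, hπ ▸ Finset.mem_union_right _ hW, hr⟩

open Classical in
/-- The weight of a partition, with `u` for the outer and `v` for the inner blocks. -/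
noncomputable def partitionWeight (u v : Finset ℕ → ℂ) {s : Finset ℕ} (π : Finpartition s) : ℂ :=
  ∏ V ∈ π.parts, if IsInnerBlock π V then v V else u V

theorem partitionWeight_self (v : Finset ℕ → ℂ) {s : Finset ℕ} (π : Finpartition s) :
    partitionWeight v v π = ∏ V ∈ π.parts, v V := by
  simp [partitionWeight]

/-- The sum of the weights of the noncrossing partitions of `s`. -/
noncomputable def ncSum (u v : Finset ℕ → ℂ) (s : Finset ℕ) : ℂ :=
  ∑ π ∈ noncrossingPartitions s, partitionWeight u v π

open Classical in
/-- The sum of the weights of the noncrossing partitions of `s` with a block containing `K`. -/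
noncomputable def ncSumOver (u v : Finset ℕ → ℂ) (K s : Finset ℕ) : ℂ :=
  ∑ π ∈ (noncrossingPartitions s).filter (fun π => ∃ W ∈ π.parts, K ⊆ W), partitionWeight u v π

open Classical in
theorem prod_join {A B s : Finset ℕ} (h : Disjoint A B) {π : Finpartition s}
    {πA : Finpartition A} {πB : Finpartition B} (hπ : π.parts = πA.parts ∪ πB.parts)
    (f : Finset ℕ → ℂ) :
    ∏ V ∈ π.parts, f V = (∏ V ∈ πA.parts, f V) * ∏ V ∈ πB.parts, f V := by
  rw [hπ, Finset.prod_union]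
  rw [Finset.disjoint_left]
  intro V hA hB
  obtain ⟨k, hk⟩ := block_nonempty hA
  exact Finset.disjoint_left.1 h (πA.le hA hk) (πB.le hB hk)

open Classical in
/-- Sums over the noncrossing partitions of `A ∪ B` whose blocks are contained in `A` or `B`. -/
theorem sum_noncrossing_split {s A B : Finset ℕ} (hs : s = A ∪ B) (hAB : IsGapOf A B)
    {P : Finpartition s → Prop} {PA : Finpartition A → Prop} {PB : Finpartition B → Prop}
    [DecidablePred P] [DecidablePred PA] [DecidablePred PB]
    (hP : ∀ π πA πB, π.parts = πA.parts ∪ πB.parts → (P π ↔ PA πA ∧ PB πB))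
    (hsplit : ∀ π, IsNoncrossing π → P π → ∀ V ∈ π.parts, V ⊆ A ∨ V ⊆ B)
    {f : Finpartition s → ℂ} {fA : Finpartition A → ℂ} {fB : Finpartition B → ℂ}
    (hf : ∀ π πA πB, π.parts = πA.parts ∪ πB.parts → PA πA → PB πB → f π = fA πA * fB πB) :
    ∑ π ∈ (noncrossingPartitions s).filter P, f π =
      (∑ π ∈ (noncrossingPartitions A).filter PA, fA π) *
        ∑ π ∈ (noncrossingPartitions B).filter PB, fB π := by
  have hd := hAB.disjoint
  choose J hJ using exists_join hs hd
  rw [Finset.sum_mul_sum, ← Finset.sum_product']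
  symm
  have hmem : ∀ {πA πB V}, V ∈ (J πA πB).parts → (V ∈ πA.parts ↔ V ⊆ A) ∧
      (V ∈ πB.parts ↔ V ⊆ B) := by
    intro πA πB V hV
    rw [hJ, Finset.mem_union] at hV
    have hne : V.Nonempty := by
      rcases hV with hV | hV <;> exact block_nonempty hV
    obtain ⟨k, hk⟩ := hne
    have h1 : V ⊆ A → V ⊆ B → False := fun h1 h2 =>
      Finset.disjoint_left.1 hd (h1 hk) (h2 hk)
    have h2 : V ∈ πA.parts → V ⊆ A := fun h => πA.le h
    have h3 : V ∈ πB.parts → V ⊆ B := fun h => πB.le h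
    tauto
  refine Finset.sum_bij (fun p _ => J p.1 p.2) ?_ ?_ ?_ ?_
  · rintro ⟨πA, πB⟩ h
    simp only [Finset.mem_product, Finset.mem_filter, mem_noncrossingPartitions] at h ⊢
    rw [hP _ _ _ (hJ πA πB), isNoncrossing_join hAB (hJ πA πB)]
    tauto
  · rintro ⟨πA, πB⟩ - ⟨πA', πB'⟩ - h
    simp only at h
    have hA : πA = πA' := by
      ext V
      constructor
      · intro hV
        have h1 : V ∈ (J πA πB).parts := by rw [hJ]; exact Finset.mem_union_left _ hV
        exact (hmem (h ▸ h1)).1.2 (πA.le hV)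
      · intro hV
        have h1 : V ∈ (J πA' πB').parts := by rw [hJ]; exact Finset.mem_union_left _ hV
        exact (hmem (h ▸ h1)).1.2 (πA'.le hV)
    have hB : πB = πB' := by
      ext V
      constructor
      · intro hV
        have h1 : V ∈ (J πA πB).parts := by rw [hJ]; exact Finset.mem_union_right _ hV
        exact (hmem (h ▸ h1)).2.2 (πB.le hV)
      · intro hV
        have h1 : V ∈ (J πA' πB').parts := by rw [hJ]; exact Finset.mem_union_right _ hV
        exact (hmem (h ▸ h1)).2.2 (πB'.le hV)
    rw [hA, hB]
  · intro π hπ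
    rw [Finset.mem_filter, mem_noncrossingPartitions] at hπ
    have hsp := hsplit π hπ.1 hπ.2
    obtain ⟨πA, hA⟩ := exists_restrict (A := A) (hs ▸ Finset.subset_union_left) π
      (fun V hV => (hsp V hV).imp id fun h => hd.symm.mono_left h)
    obtain ⟨πB, hB⟩ := exists_restrict (A := B) (hs ▸ Finset.subset_union_right) π
      (fun V hV => (hsp V hV).symm.imp id fun h => hd.mono_left h)
    have hu : π.parts = πA.parts ∪ πB.parts := by
      ext V
      rw [Finset.mem_union, hA, hB]
      have := hsp V
      tauto
    refine ⟨(πA, πB), ?_, ?_⟩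
    · simp only [Finset.mem_product, Finset.mem_filter, mem_noncrossingPartitions]
      have h1 := (hP _ _ _ hu).1 hπ.2
      have h2 := (isNoncrossing_join hAB hu).1 hπ.1
      tauto
    · exact Finpartition.ext (by rw [hJ, hu])
  · rintro ⟨πA, πB⟩ h
    simp only [Finset.mem_product, Finset.mem_filter] at h
    exact (hf _ _ _ (hJ πA πB) h.1.2 h.2.2).symm

open Classical in
theorem sum_filter_mem_parts {s : Finset ℕ} (hs : s.Nonempty) (f : Finpartition s → ℂ) :
    ∑ π ∈ (noncrossingPartitions s).filter (fun π => s ∈ π.parts), f π =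
      f (Finpartition.indiscrete hs.ne_empty) := by
  have h := sum_noncrossing_eq hs (fun π => if s ∈ π.parts then f π else 0)
  rw [Finset.sum_filter, h, Finset.sum_eq_zero, add_zero, if_pos (by simp)]
  intro π hπ
  exact if_neg (Finset.mem_filter.1 hπ).2

open Classical in
/-- The partitions of `V ∪ t`, `V < t`, in which `V` is a block. -/
theorem sum_filter_initial_block (u v : Finset ℕ → ℂ) {V t : Finset ℕ} (hV : V.Nonempty)
    (hVt : ∀ a ∈ V, ∀ b ∈ t, a < b) :
    ∑ π ∈ (noncrossingPartitions (V ∪ t)).filter (fun π => V ∈ π.parts), partitionWeight u v π =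
      u V * ncSum u v t := by
  have hgap : IsGapOf V t := fun b hb => Or.inr fun a ha => hVt a ha b hb
  rw [sum_noncrossing_split (A := V) (B := t)
    (P := fun π => V ∈ π.parts) (f := partitionWeight u v) (PA := fun π => V ∈ π.parts) (PB := fun _ => True)
    (fA := fun _ => u V) (fB := partitionWeight u v) rfl hgap]
  · rw [sum_filter_mem_parts hV, Finset.filter_true]; rfl
  · intro π πA πB hπ
    rw [hπ, Finset.mem_union, and_true, or_iff_left]
    intro h
    obtain ⟨x, hx⟩ := hV
    exact Finset.disjoint_left.1 hgap.disjoint hx (πB.le h hx)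
  · intro π _ hV' W hW
    by_cases h : W = V
    · exact Or.inl (h ▸ subset_rfl)
    · right
      intro x hx
      rcases Finset.mem_union.1 (π.le hW hx) with hx' | hx'
      · exact absurd (block_unique hW hV' hx hx') h
      · exact hx'
  · intro π πA πB hπ hA _
    rw [partitionWeight, prod_join hgap.disjoint hπ, parts_eq_of_mem hA, Finset.prod_singleton,
      if_neg]
    · congr 1
      refine Finset.prod_congr rfl fun W hW => ?_
      rw [isInnerBlock_join_right hgap hπ hW]
    · rintro ⟨W, hW, hne, p, hp, q, hq, hk⟩
      rw [hπ, parts_eq_of_mem hA, Finset.mem_union, Finset.mem_singleton] at hW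
      rcases hW with hW | hW
      · exact hne hW
      · obtain ⟨x, hx⟩ := hV
        have h1 := hVt x hx p (πB.le hW hp)
        have h2 := hk x hx
        omega

open Classical in
/-- The partitions of `V ∪ t`, `V < t`, in which the block of `V` continues with `j ∈ t`. -/
theorem sum_filter_next (u v : Finset ℕ → ℂ) {V t : Finset ℕ} (hV : V.Nonempty)
    (hVt : ∀ a ∈ V, ∀ b ∈ t, a < b) {j : ℕ} (hj : j ∈ t) :
    ∑ π ∈ (noncrossingPartitions (V ∪ t)).filter
        (fun π => ∃ W ∈ π.parts, insert j V ⊆ W ∧ ∀ k ∈ W, k ∈ t → j ≤ k),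
        partitionWeight u v π =
      ncSum v v (t.filter (· < j)) *
        ncSumOver u v (insert j V) (insert j V ∪ t.filter (j < ·)) := by
  have hgap : IsGapOf (t.filter (· < j)) (insert j V ∪ t.filter (j < ·)) := by
    intro b hb
    rw [Finset.mem_union, Finset.mem_insert, Finset.mem_filter] at hb
    rcases hb with (rfl | hb) | hb
    · right
      intro a ha
      exact (Finset.mem_filter.1 ha).2
    · left
      intro a ha
      exact hVt b hb a (Finset.mem_filter.1 ha).1
    · right
      intro a ha
      exact (Finset.mem_filter.1 ha).2.trans hb.2
  obtain ⟨x, hx⟩ := hV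
  rw [sum_noncrossing_split (A := t.filter (· < j)) (B := insert j V ∪ t.filter (j < ·))
    (P := fun π => ∃ W ∈ π.parts, insert j V ⊆ W ∧ ∀ k ∈ W, k ∈ t → j ≤ k)
    (f := partitionWeight u v)
    (PA := fun _ => True) (PB := fun π => ∃ W ∈ π.parts, insert j V ⊆ W)
    (fA := partitionWeight v v) (fB := partitionWeight u v) ?_ hgap]
  · rw [Finset.filter_true]; rfl
  · intro π πA πB hπ
    rw [true_and]
    constructor
    · rintro ⟨W, hW, hsub, hmin⟩
      rw [hπ, Finset.mem_union] at hW
      rcases hW with hW | hW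
      · exact absurd (Finset.mem_filter.1 (πA.le hW (hsub (Finset.mem_insert_self _ _)))).2
          (lt_irrefl _)
      · exact ⟨W, hW, hsub⟩
    · rintro ⟨W, hW, hsub⟩
      refine ⟨W, hπ ▸ Finset.mem_union_right _ hW, hsub, fun k hk hkt => ?_⟩
      by_contra hlt
      exact Finset.disjoint_left.1 hgap.disjoint (Finset.mem_filter.2 ⟨hkt, not_le.1 hlt⟩)
        (πB.le hW hk)
  · rintro π hn ⟨W, hW, hsub, hmin⟩ U hU
    have hmem : ∀ k ∈ U, k ∈ V ∨ k ∈ t := fun k hk => Finset.mem_union.1 (π.le hU hk)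
    by_cases hUW : U = W
    · right
      intro k hk
      rcases hmem k hk with h | h
      · exact Finset.mem_union_left _ (Finset.mem_insert_of_mem h)
      · rcases (hmin k (hUW ▸ hk) h).eq_or_lt with h' | h'
        · exact Finset.mem_union_left _ (by simp [h'])
        · exact Finset.mem_union_right _ (Finset.mem_filter.2 ⟨h, h'⟩)
    · have hnot : ∀ k ∈ U, k ∈ t ∧ k ≠ j := by
        intro k hk
        refine ⟨(hmem k hk).resolve_left fun h => hUW ?_, fun h => hUW ?_⟩
        · exact block_unique hU hW hk (hsub (Finset.mem_insert_of_mem h))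
        · exact block_unique hU hW hk (hsub (by simp [h]))
      -- A block other than `W` cannot have points on both sides of `j`: together with `x` and `j`
      -- in `W` they would form a crossing.
      by_cases hlt : ∃ k ∈ U, k < j
      · obtain ⟨k, hk, hkj⟩ := hlt
        left
        intro l hl
        refine Finset.mem_filter.2 ⟨(hnot l hl).1, ?_⟩
        by_contra hlj
        have hjl : j < l := lt_of_le_of_ne (not_lt.1 hlj) (hnot l hl).2.symm
        exact hUW (hn W hW U hU x (hsub (Finset.mem_insert_of_mem hx)) k hk j
          (hsub (Finset.mem_insert_self _ _)) l hl (hVt x hx k (hnot k hk).1) hkj hjl).symm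
      · right
        intro k hk
        refine Finset.mem_union_right _ (Finset.mem_filter.2 ⟨(hnot k hk).1, ?_⟩)
        push Not at hlt
        exact lt_of_le_of_ne (hlt k hk) (hnot k hk).2.symm
  · rintro π πA πB hπ - ⟨W, hW, hsub⟩
    rw [partitionWeight, prod_join hgap.disjoint hπ, partitionWeight_self]
    congr 1
    -- Everything between `V` and `j` is nested in `W`, hence inner; this is why the first factor
    -- carries the weights `v` only.
    · refine Finset.prod_congr rfl fun U hU => if_pos ?_
      refine ⟨W, hπ ▸ Finset.mem_union_right _ hW, ?_, x, hsub (Finset.mem_insert_of_mem hx), j,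
        hsub (Finset.mem_insert_self _ _), fun k hk => ?_⟩
      · rintro rfl
        obtain ⟨k, hk⟩ := block_nonempty hW
        exact Finset.disjoint_left.1 hgap.disjoint (πA.le hU hk) (πB.le hW hk)
      · have := Finset.mem_filter.1 (πA.le hU hk)
        exact ⟨(hVt x hx k this.1).le, this.2.le⟩
    · refine Finset.prod_congr rfl fun U hU => ?_
      rw [isInnerBlock_join_right hgap hπ hU]
  · ext k
    simp only [Finset.mem_union, Finset.mem_filter, Finset.mem_insert]
    rcases lt_trichotomy k j with h | h | h
    · have h1 : k ≠ j := h.ne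
      have h2 : ¬ j < k := by omega
      tauto
    · subst h
      tauto
    · have h1 : k ≠ j := h.ne'
      have h2 : ¬ k < j := by omega
      tauto

open Classical in
/-- The recursion over the next element of the block which starts with `V`. -/
theorem ncSumOver_eq (u v : Finset ℕ → ℂ) {V t : Finset ℕ} (hV : V.Nonempty)
    (hVt : ∀ a ∈ V, ∀ b ∈ t, a < b) :
    ncSumOver u v V (V ∪ t) = u V * ncSum u v t +
      ∑ j ∈ t, ncSum v v (t.filter (· < j)) *
        ncSumOver u v (insert j V) (insert j V ∪ t.filter (j < ·)) := by
  obtain ⟨x, hx⟩ := hV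
  have hxt : ∀ b ∈ t, b ∉ V := fun b hb hbV => lt_irrefl _ (hVt b hbV b hb)
  rw [← sum_filter_initial_block u v ⟨x, hx⟩ hVt,
    Finset.sum_congr rfl fun j hj => (sum_filter_next u v ⟨x, hx⟩ hVt hj).symm,
    ← Finset.sum_biUnion, ← Finset.sum_union, ncSumOver]
  · refine Finset.sum_congr ?_ fun _ _ => rfl
    ext π
    simp only [Finset.mem_union, Finset.mem_biUnion, Finset.mem_filter]
    constructor
    · rintro ⟨hn, W, hW, hsub⟩
      -- The index `j` of the summand is the least element of `W` in `t`; if there is none, `W = V`.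
      by_cases hne : (W.filter (· ∈ t)).Nonempty
      · right
        have hm := Finset.mem_filter.1 (Finset.min'_mem _ hne)
        refine ⟨_, hm.2, hn, W, hW, Finset.insert_subset hm.1 hsub, fun k hk hkt => ?_⟩
        exact Finset.min'_le _ _ (Finset.mem_filter.2 ⟨hk, hkt⟩)
      · left
        refine ⟨hn, ?_⟩
        have : W = V := by
          refine Finset.Subset.antisymm (fun k hk => ?_) hsub
          rcases Finset.mem_union.1 (π.le hW hk) with h | h
          · exact h
          · exact absurd ⟨k, Finset.mem_filter.2 ⟨hk, h⟩⟩ hne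
        rwa [this] at hW
    · rintro (⟨hn, h⟩ | ⟨j, -, hn, W, hW, hsub, -⟩)
      · exact ⟨hn, V, h, subset_rfl⟩
      · exact ⟨hn, W, hW, (Finset.subset_insert _ _).trans hsub⟩
  · rw [Finset.disjoint_left]
    intro π h1 h2
    simp only [Finset.mem_biUnion, Finset.mem_filter] at h1 h2
    obtain ⟨j, hj, -, W, hW, hsub, -⟩ := h2
    have := block_unique h1.2 hW hx (hsub (Finset.mem_insert_of_mem hx))
    exact hxt j hj (this ▸ hsub (Finset.mem_insert_self _ _))
  · intro i hi j hj hij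
    rw [Function.onFun, Finset.disjoint_left]
    intro π h1 h2
    simp only [Finset.mem_filter] at h1 h2
    obtain ⟨-, W, hW, hsub, hmin⟩ := h1
    obtain ⟨-, U, hU, hsub', hmin'⟩ := h2
    have hWU := block_unique hW hU (hsub (Finset.mem_insert_of_mem hx))
      (hsub' (Finset.mem_insert_of_mem hx))
    subst hWU
    exact hij (le_antisymm (hmin j (hsub' (Finset.mem_insert_self _ _)) hj)
      (hmin' i (hsub (Finset.mem_insert_self _ _)) hi))

theorem ncSum_empty (u v : Finset ℕ → ℂ) : ncSum u v ∅ = 1 := by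
  classical
  have hp : ∀ π : Finpartition (∅ : Finset ℕ), π.parts = ∅ := by
    intro π
    refine Finset.eq_empty_of_forall_notMem fun V hV => ?_
    obtain ⟨k, hk⟩ := block_nonempty hV
    exact absurd (π.le hV hk) (Finset.notMem_empty k)
  have h : noncrossingPartitions ∅ = {Finpartition.empty (Finset ℕ)} := by
    refine Finset.eq_singleton_iff_unique_mem.2 ⟨?_, fun π _ => ?_⟩
    · rw [mem_noncrossingPartitions]
      intro V hV
      exact absurd (hp (Finpartition.empty (Finset ℕ)) ▸ hV) (Finset.notMem_empty V)
    · exact Finpartition.ext ((hp π).trans (hp _).symm)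
  rw [ncSum, h, Finset.sum_singleton, partitionWeight]
  exact Finset.prod_eq_one fun V hV =>
    absurd (hp (Finpartition.empty (Finset ℕ)) ▸ hV) (Finset.notMem_empty V)

theorem ncSum_eq_ncSumOver_singleton (u v : Finset ℕ → ℂ) {s : Finset ℕ} {a : ℕ} (ha : a ∈ s) :
    ncSum u v s = ncSumOver u v {a} s := by
  classical
  rw [ncSum, ncSumOver, Finset.filter_true_of_mem]
  intro π _
  obtain ⟨W, hW, haW⟩ := π.exists_mem ha
  exact ⟨W, hW, Finset.singleton_subset_iff.2 haW⟩

theorem ncSumOver_self (u v : Finset ℕ → ℂ) {V : Finset ℕ} (hV : V.Nonempty) :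
    ncSumOver u v V V = u V := by
  have := ncSumOver_eq u v hV (t := ∅) (by simp)
  simpa [ncSum_empty] using this

theorem not_isInnerBlock_of_min {s : Finset ℕ} {π : Finpartition s} {V : Finset ℕ} {a : ℕ}
    (hV : V ∈ π.parts) (haV : a ∈ V) (hmin : ∀ k ∈ s, a ≤ k) : ¬ IsInnerBlock π V := by
  rintro ⟨W, hW, hne, p, hp, q, hq, hk⟩
  have h1 := hmin p (π.le hW hp)
  have h2 := (hk a haV).1
  exact hne (block_unique hW hV (le_antisymm h2 h1 ▸ hp) haV)

/-- The block of the minimum `a` is outer, so its weight is a value of `u`, which vanishes unless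
the block also contains `j`. -/
theorem ncSum_eq_ncSumOver_pair (u v : Finset ℕ → ℂ) {s : Finset ℕ} {a j : ℕ} (ha : a ∈ s)
    (hmin : ∀ k ∈ s, a ≤ k) (hu : ∀ V, V ⊆ s → a ∈ V → j ∉ V → u V = 0) :
    ncSum u v s = ncSumOver u v {a, j} s := by
  classical
  rw [ncSum, ncSumOver, Finset.sum_filter]
  refine Finset.sum_congr rfl fun π _ => ?_
  split_ifs with h
  · rfl
  · obtain ⟨W, hW, haW⟩ := π.exists_mem ha
    refine Finset.prod_eq_zero hW ?_
    rw [if_neg (not_isInnerBlock_of_min hW haW hmin)]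
    refine hu W (π.le hW) haW fun hj => h ⟨W, hW, ?_⟩
    intro k hk
    rcases Finset.mem_insert.1 hk with rfl | hk
    · exact haW
    · exact (Finset.mem_singleton.1 hk) ▸ hj

/-- The block through `K` contains the minimum and is therefore outer, so `v` and `v'` need not
agree on it. This is what makes freeness with respect to `ψ` unnecessary in the first claim. -/
theorem ncSumOver_congr {u v u' v' : Finset ℕ → ℂ} {K s : Finset ℕ} {a : ℕ} (ha : a ∈ K)
    (hmin : ∀ k ∈ s, a ≤ k) (h1 : ∀ V, V ⊆ s → K ⊆ V → u V = u' V)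
    (h2 : ∀ V, V.Nonempty → V ⊆ s → Disjoint K V → u V = u' V ∧ v V = v' V) :
    ncSumOver u v K s = ncSumOver u' v' K s := by
  classical
  refine Finset.sum_congr rfl fun π hπ => Finset.prod_congr rfl fun V hV => ?_
  obtain ⟨-, W, hW, hK⟩ := Finset.mem_filter.1 hπ
  by_cases hVW : V = W
  · subst hVW
    rw [if_neg (not_isInnerBlock_of_min hV (hK ha) hmin),
      if_neg (not_isInnerBlock_of_min hV (hK ha) hmin), h1 V (π.le hV) hK]
  · have := h2 V (block_nonempty hV) (π.le hV) ((π.disjoint hV hW hVW).symm.mono_left hK)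
    rw [this.1, this.2]

/-! ### Cumulants -/

section CumulantLemmas

variable {A : Type*} [Ring A] [Algebra ℂ A]

theorem jointMoment_empty {φ : A →ₗ[ℂ] ℂ} (hφ : φ 1 = 1) (a : ℕ → A) :
    jointMoment φ a ∅ = 1 := by
  simp [jointMoment, hφ]

theorem jointMoment_const (φ : A →ₗ[ℂ] ℂ) (x : A) (s : Finset ℕ) :
    jointMoment φ (fun _ => x) s = φ (x ^ s.card) := by
  simp [jointMoment]

theorem ncSum_freeCumulant {ψ : A →ₗ[ℂ] ℂ} (hψ : ψ 1 = 1) (a : ℕ → A) (s : Finset ℕ) :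
    ncSum (freeCumulant ψ a) (freeCumulant ψ a) s = jointMoment ψ a s := by
  rcases s.eq_empty_or_nonempty with rfl | hs
  · rw [ncSum_empty, jointMoment_empty hψ]
  · rw [jointMoment_eq_sum_freeCumulant ψ a hs]
    exact Finset.sum_congr rfl fun π _ => partitionWeight_self _ π

theorem ncSum_twoStateCumulant {φ : A →ₗ[ℂ] ℂ} (hφ : φ 1 = 1) (ψ : A →ₗ[ℂ] ℂ) (a : ℕ → A)
    (s : Finset ℕ) :
    ncSum (twoStateCumulant φ ψ a) (freeCumulant ψ a) s = jointMoment φ a s := by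
  rcases s.eq_empty_or_nonempty with rfl | hs
  · rw [ncSum_empty, jointMoment_empty hφ]
  · exact (jointMoment_eq_sum_twoStateCumulant φ ψ a hs).symm

open Classical in
theorem freeCumulant_eq_sub (ψ : A →ₗ[ℂ] ℂ) (a : ℕ → A) (s : Finset ℕ) :
    freeCumulant ψ a s = jointMoment ψ a s -
      ∑ π ∈ (noncrossingPartitions s).filter fun π => s ∉ π.parts,
        ∏ V ∈ π.parts, freeCumulant ψ a V := by
  rw [freeCumulant, Finset.sum_attach _ (fun π : Finpartition s =>
    ∏ V ∈ π.parts.attach, freeCumulant ψ a V.1)]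
  simp only [Finset.prod_attach _ (fun V => freeCumulant ψ a V)]

open Classical in
theorem twoStateCumulant_eq_sub (φ ψ : A →ₗ[ℂ] ℂ) (a : ℕ → A) (s : Finset ℕ) :
    twoStateCumulant φ ψ a s = jointMoment φ a s -
      ∑ π ∈ (noncrossingPartitions s).filter fun π => s ∉ π.parts,
        ∏ V ∈ π.parts,
          if IsInnerBlock π V then freeCumulant ψ a V else twoStateCumulant φ ψ a V := by
  rw [twoStateCumulant, Finset.sum_attach _ (fun π : Finpartition s => ∏ V ∈ π.parts.attach,
    if IsInnerBlock π V.1 then freeCumulant ψ a V.1 else twoStateCumulant φ ψ a V.1)]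
  congr 1
  exact Finset.sum_congr rfl fun π _ => Finset.prod_attach _ (fun V =>
    if IsInnerBlock π V then freeCumulant ψ a V else twoStateCumulant φ ψ a V)

/-- The recursion expresses the cumulant by moments on subsets of `s` alone. -/
theorem freeCumulant_eq_of_jointMoment_eq {ψ : A →ₗ[ℂ] ℂ} {a a' : ℕ → A} (s : Finset ℕ)
    (h : ∀ V ⊆ s, jointMoment ψ a V = jointMoment ψ a' V) :
    freeCumulant ψ a s = freeCumulant ψ a' s := by
  classical
  induction s using Finset.strongInduction with
  | H s ih =>
    rw [freeCumulant_eq_sub, freeCumulant_eq_sub, h s subset_rfl]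
    congr 1
    refine Finset.sum_congr rfl fun π hπ => Finset.prod_congr rfl fun V hV => ?_
    have hVs : V ⊂ s := (π.le hV).ssubset_of_ne fun hVs =>
      (Finset.mem_filter.1 hπ).2 (hVs ▸ hV)
    exact ih V hVs fun U hU => h U (hU.trans (π.le hV))

theorem twoStateCumulant_eq_of_jointMoment_eq {φ ψ : A →ₗ[ℂ] ℂ} {a a' : ℕ → A} (s : Finset ℕ)
    (hφ : ∀ V ⊆ s, jointMoment φ a V = jointMoment φ a' V)
    (hψ : ∀ V ⊆ s, jointMoment ψ a V = jointMoment ψ a' V) :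
    twoStateCumulant φ ψ a s = twoStateCumulant φ ψ a' s := by
  classical
  induction s using Finset.strongInduction with
  | H s ih =>
    rw [twoStateCumulant_eq_sub, twoStateCumulant_eq_sub, hφ s subset_rfl]
    congr 1
    refine Finset.sum_congr rfl fun π hπ => Finset.prod_congr rfl fun V hV => ?_
    have hVs : V ⊂ s := (π.le hV).ssubset_of_ne fun hVs =>
      (Finset.mem_filter.1 hπ).2 (hVs ▸ hV)
    rw [ih V hVs (fun U hU => hφ U (hU.trans (π.le hV))) fun U hU => hψ U (hU.trans (π.le hV)),
      freeCumulant_eq_of_jointMoment_eq V fun U hU => hψ U (hU.trans (π.le hV))]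

theorem jointMoment_congr (φ : A →ₗ[ℂ] ℂ) {a a' : ℕ → A} {s : Finset ℕ}
    (h : ∀ i ∈ s, a i = a' i) : jointMoment φ a s = jointMoment φ a' s := by
  rw [jointMoment, jointMoment]
  congr 2
  exact List.map_congr_left fun i hi => h i ((Finset.mem_sort _).1 hi)

theorem freeCumulant_congr (ψ : A →ₗ[ℂ] ℂ) {a a' : ℕ → A} {s : Finset ℕ}
    (h : ∀ i ∈ s, a i = a' i) : freeCumulant ψ a s = freeCumulant ψ a' s :=
  freeCumulant_eq_of_jointMoment_eq s fun _ hV => jointMoment_congr ψ fun i hi => h i (hV hi)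

theorem twoStateCumulant_congr (φ ψ : A →ₗ[ℂ] ℂ) {a a' : ℕ → A} {s : Finset ℕ}
    (h : ∀ i ∈ s, a i = a' i) : twoStateCumulant φ ψ a s = twoStateCumulant φ ψ a' s :=
  twoStateCumulant_eq_of_jointMoment_eq s
    (fun _ hV => jointMoment_congr φ fun i hi => h i (hV hi))
    fun _ hV => jointMoment_congr ψ fun i hi => h i (hV hi)

/-- `a` is a linear combination of `a₁` and `a₂` in the entry `i`; the other entries agree. -/
structure IsCombAt (i : ℕ) (p q : ℂ) (a a₁ a₂ : ℕ → A) : Prop where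
  at_eq : a i = p • a₁ i + q • a₂ i
  left : ∀ k, k ≠ i → a k = a₁ k
  right : ∀ k, k ≠ i → a k = a₂ k

theorem jointMoment_comb (φ : A →ₗ[ℂ] ℂ) {i : ℕ} {p q : ℂ} {a a₁ a₂ : ℕ → A}
    (h : IsCombAt i p q a a₁ a₂) {s : Finset ℕ} (hi : i ∈ s) :
    jointMoment φ a s = p * jointMoment φ a₁ s + q * jointMoment φ a₂ s := by
  have key : ∀ l : List ℕ, l.Nodup → i ∈ l →
      (l.map a).prod = p • (l.map a₁).prod + q • (l.map a₂).prod := by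
    intro l hl hil
    obtain ⟨l₁, l₂, rfl⟩ := List.append_of_mem hil
    have hn : i ∉ l₁ ∧ i ∉ l₂ := by
      rw [List.nodup_append] at hl
      obtain ⟨-, h2, h3⟩ := hl
      exact ⟨fun h' => h3 i h' i List.mem_cons_self rfl, (List.nodup_cons.1 h2).1⟩
    have e : ∀ (b : ℕ → A), (∀ k, k ≠ i → a k = b k) →
        l₁.map b = l₁.map a ∧ l₂.map b = l₂.map a := fun b hb =>
      ⟨List.map_congr_left fun k hk => (hb k fun h' => hn.1 (h' ▸ hk)).symm,
        List.map_congr_left fun k hk => (hb k fun h' => hn.2 (h' ▸ hk)).symm⟩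
    simp only [List.map_append, List.map_cons, List.prod_append, List.prod_cons,
      (e a₁ h.left).1, (e a₁ h.left).2, (e a₂ h.right).1, (e a₂ h.right).2, h.at_eq]
    simp only [mul_add, add_mul, smul_mul_assoc, mul_smul_comm]
  rw [jointMoment, key _ (Finset.sort_nodup _ _) ((Finset.mem_sort _).2 hi)]
  simp [jointMoment]

/-- Exactly one block contains `i`, so linearity in that one factor passes to the product. -/
theorem prod_blocks_comb {s : Finset ℕ} (π : Finpartition s) {i : ℕ} (hi : i ∈ s) {p q : ℂ}
    {f f₁ f₂ : Finset ℕ → ℂ}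
    (h : ∀ V ∈ π.parts, i ∈ V → f V = p * f₁ V + q * f₂ V)
    (h' : ∀ V ∈ π.parts, i ∉ V → f V = f₁ V ∧ f V = f₂ V) :
    ∏ V ∈ π.parts, f V = p * ∏ V ∈ π.parts, f₁ V + q * ∏ V ∈ π.parts, f₂ V := by
  classical
  obtain ⟨W, hW, hiW⟩ := π.exists_mem hi
  have hn : ∀ V ∈ π.parts.erase W, f V = f₁ V ∧ f V = f₂ V := by
    intro V hV
    rw [Finset.mem_erase] at hV
    exact h' V hV.2 fun hiV => hV.1 (block_unique hV.2 hW hiV hiW)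
  rw [← Finset.mul_prod_erase _ _ hW, ← Finset.mul_prod_erase _ f₁ hW,
    ← Finset.mul_prod_erase _ f₂ hW, ← Finset.prod_congr rfl fun V hV => (hn V hV).1,
    ← Finset.prod_congr rfl fun V hV => (hn V hV).2, h W hW hiW]
  ring

theorem freeCumulant_comb (ψ : A →ₗ[ℂ] ℂ) {i : ℕ} {p q : ℂ} {a a₁ a₂ : ℕ → A}
    (h : IsCombAt i p q a a₁ a₂) (s : Finset ℕ) (hi : i ∈ s) :
    freeCumulant ψ a s = p * freeCumulant ψ a₁ s + q * freeCumulant ψ a₂ s := by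
  classical
  induction s using Finset.strongInduction with
  | H s ih =>
    have key : ∀ π ∈ (noncrossingPartitions s).filter (fun π => s ∉ π.parts),
        ∏ V ∈ π.parts, freeCumulant ψ a V =
          p * ∏ V ∈ π.parts, freeCumulant ψ a₁ V + q * ∏ V ∈ π.parts, freeCumulant ψ a₂ V := by
      intro π hπ
      refine prod_blocks_comb π hi (fun V hV hiV => ?_) fun V hV hiV => ?_
      · exact ih V ((π.le hV).ssubset_of_ne fun hVs =>
          (Finset.mem_filter.1 hπ).2 (hVs ▸ hV)) hiV
      · exact ⟨freeCumulant_congr ψ fun k hk => h.left k fun h' => hiV (h' ▸ hk),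
          freeCumulant_congr ψ fun k hk => h.right k fun h' => hiV (h' ▸ hk)⟩
    rw [freeCumulant_eq_sub ψ a, freeCumulant_eq_sub ψ a₁, freeCumulant_eq_sub ψ a₂,
      Finset.sum_congr rfl key, jointMoment_comb ψ h hi, Finset.sum_add_distrib,
      ← Finset.mul_sum, ← Finset.mul_sum]
    ring

theorem twoStateCumulant_comb (φ ψ : A →ₗ[ℂ] ℂ) {i : ℕ} {p q : ℂ} {a a₁ a₂ : ℕ → A}
    (h : IsCombAt i p q a a₁ a₂) (s : Finset ℕ) (hi : i ∈ s) :
    twoStateCumulant φ ψ a s =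
      p * twoStateCumulant φ ψ a₁ s + q * twoStateCumulant φ ψ a₂ s := by
  classical
  induction s using Finset.strongInduction with
  | H s ih =>
    have key : ∀ π ∈ (noncrossingPartitions s).filter (fun π => s ∉ π.parts),
        (∏ V ∈ π.parts,
          if IsInnerBlock π V then freeCumulant ψ a V else twoStateCumulant φ ψ a V) =
        p * (∏ V ∈ π.parts,
          if IsInnerBlock π V then freeCumulant ψ a₁ V else twoStateCumulant φ ψ a₁ V) +
        q * ∏ V ∈ π.parts,
          if IsInnerBlock π V then freeCumulant ψ a₂ V else twoStateCumulant φ ψ a₂ V := by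
      intro π hπ
      refine prod_blocks_comb π hi (fun V hV hiV => ?_) fun V hV hiV => ?_
      · split_ifs
        · exact freeCumulant_comb ψ h V hiV
        · exact ih V ((π.le hV).ssubset_of_ne fun hVs =>
            (Finset.mem_filter.1 hπ).2 (hVs ▸ hV)) hiV
      · have hl : ∀ k ∈ V, a k = a₁ k := fun k hk => h.left k fun h' => hiV (h' ▸ hk)
        have hr : ∀ k ∈ V, a k = a₂ k := fun k hk => h.right k fun h' => hiV (h' ▸ hk)
        rw [← freeCumulant_congr ψ hl, ← freeCumulant_congr ψ hr,
          ← twoStateCumulant_congr φ ψ hl, ← twoStateCumulant_congr φ ψ hr]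
        exact ⟨rfl, rfl⟩
    rw [twoStateCumulant_eq_sub φ ψ a, twoStateCumulant_eq_sub φ ψ a₁,
      twoStateCumulant_eq_sub φ ψ a₂, Finset.sum_congr rfl key, jointMoment_comb φ h hi,
      Finset.sum_add_distrib, ← Finset.mul_sum, ← Finset.mul_sum]
    ring

/-- A multilinear functional with vanishing mixed values, on words in combinations of `X, Y`. -/
theorem eq_add_of_mixed_eq_zero {κ : (ℕ → A) → ℂ} {V : Finset ℕ} (hV : V.Nonempty) {X Y : A}
    (hcongr : ∀ a a', (∀ i ∈ V, a i = a' i) → κ a = κ a')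
    (hcomb : ∀ i ∈ V, ∀ p q a a₁ a₂, IsCombAt i p q a a₁ a₂ → κ a = p * κ a₁ + q * κ a₂)
    (hmix : ∀ ε : ℕ → Bool, (∃ i ∈ V, ∃ j ∈ V, ε i ≠ ε j) →
      κ (fun i => if ε i then X else Y) = 0) (p q : ℕ → ℂ) :
    κ (fun i => p i • X + q i • Y) =
      (∏ i ∈ V, p i) * κ (fun _ => X) + (∏ i ∈ V, q i) * κ (fun _ => Y) := by
  classical
  -- Multilinear expansion, one entry at a time: entries in `T` are combinations, the others are
  -- letters chosen by `ε`. A pure word in `X` or in `Y` survives only if all letters outside `T`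
  -- already agree with it.
  have key : ∀ T ⊆ V, ∀ ε : ℕ → Bool,
      κ (fun i => if i ∈ T then p i • X + q i • Y else if ε i then X else Y) =
        (if ∀ i ∈ V \ T, ε i = true then ∏ i ∈ T, p i else 0) * κ (fun _ => X) +
        (if ∀ i ∈ V \ T, ε i = false then ∏ i ∈ T, q i else 0) * κ (fun _ => Y) := by
    intro T
    induction T using Finset.induction_on with
    | empty =>
      intro _ ε
      simp only [Finset.notMem_empty, if_false, Finset.sdiff_empty, Finset.prod_empty]
      obtain ⟨x, hx⟩ := hV
      by_cases h1 : ∀ i ∈ V, ε i = true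
      · rw [if_pos h1, if_neg, zero_mul, add_zero, one_mul]
        · exact hcongr _ _ fun i hi => by simp [h1 i hi]
        · intro h2
          exact absurd ((h1 x hx).symm.trans (h2 x hx)) (by decide)
      · rw [if_neg h1]
        by_cases h2 : ∀ i ∈ V, ε i = false
        · rw [if_pos h2, zero_mul, zero_add, one_mul]
          exact hcongr _ _ fun i hi => by simp [h2 i hi]
        · rw [if_neg h2, zero_mul, zero_mul, add_zero]
          push Not at h1 h2
          obtain ⟨i, hi, hi'⟩ := h1
          obtain ⟨j, hj, hj'⟩ := h2
          refine hmix ε ⟨i, hi, j, hj, fun h => hi' ?_⟩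
          rw [h]
          simpa using hj'
    | insert i T hiT ih =>
      intro hT ε
      have hTV := (Finset.subset_insert i T).trans hT
      have hiV := hT (Finset.mem_insert_self i T)
      rw [hcomb i hiV (p i) (q i) _
        (fun k => if k ∈ T then p k • X + q k • Y
          else if Function.update ε i true k then X else Y)
        (fun k => if k ∈ T then p k • X + q k • Y
          else if Function.update ε i false k then X else Y) ?_, ih hTV, ih hTV]
      · have hsd : V \ T = insert i (V \ insert i T) := by
          ext k
          simp only [Finset.mem_sdiff, Finset.mem_insert]
          by_cases hk : k = i
          · subst hk; tauto
          · tauto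
        have hne : ∀ k ∈ V \ insert i T, k ≠ i := by
          rintro k hk rfl
          simp at hk
        have e : ∀ b c : Bool, (∀ k ∈ V \ T, Function.update ε i b k = c) ↔
            b = c ∧ ∀ k ∈ V \ insert i T, ε k = c := by
          intro b c
          rw [hsd, Finset.forall_mem_insert, Function.update_self]
          refine and_congr_right fun _ => forall₂_congr fun k hk => ?_
          rw [Function.update_of_ne (hne k hk)]
        simp only [e, Finset.prod_insert hiT, true_and, reduceCtorEq, false_and, if_false]
        split_ifs <;> ring
      · constructor
        · simp [hiT]
        · intro k hk
          simp [hk]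
        · intro k hk
          simp [hk]
  have h := key V subset_rfl fun _ => true
  rw [hcongr _ (fun i => if i ∈ V then p i • X + q i • Y else if true then X else Y)
    fun i hi => by simp [hi], h]
  simp

theorem freeCumulant_combination {ψ : A →ₗ[ℂ] ℂ} {X Y : A} (hfree : IsFreePair ψ X Y)
    {V : Finset ℕ} (hV : V.Nonempty) (p q : ℕ → ℂ) :
    freeCumulant ψ (fun i => p i • X + q i • Y) V =
      (∏ i ∈ V, p i) * freeCumulant ψ (fun _ => X) V +
        (∏ i ∈ V, q i) * freeCumulant ψ (fun _ => Y) V :=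
  eq_add_of_mixed_eq_zero (κ := fun a => freeCumulant ψ a V) hV
    (fun _ _ h => freeCumulant_congr ψ h) (fun _ hi _ _ _ _ _ h => freeCumulant_comb ψ h V hi)
    (fun ε h => hfree ε V h) p q

theorem twoStateCumulant_combination {φ ψ : A →ₗ[ℂ] ℂ} {X Y : A} (hfree : IsTwoStateFree φ ψ X Y)
    {V : Finset ℕ} (hV : V.Nonempty) (p q : ℕ → ℂ) :
    twoStateCumulant φ ψ (fun i => p i • X + q i • Y) V =
      (∏ i ∈ V, p i) * twoStateCumulant φ ψ (fun _ => X) V +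
        (∏ i ∈ V, q i) * twoStateCumulant φ ψ (fun _ => Y) V :=
  eq_add_of_mixed_eq_zero (κ := fun a => twoStateCumulant φ ψ a V) hV
    (fun _ _ h => twoStateCumulant_congr φ ψ h)
    (fun _ hi _ _ _ _ _ h => twoStateCumulant_comb φ ψ h V hi)
    (fun ε h => hfree ε V h) p q

theorem freeCumulant_eq_of_moments_eq {ψ : A →ₗ[ℂ] ℂ} {X Y : A}
    (hψ : ∀ n : ℕ, ψ (X ^ n) = ψ (Y ^ n)) (V : Finset ℕ) :
    freeCumulant ψ (fun _ => Y) V = freeCumulant ψ (fun _ => X) V :=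
  freeCumulant_eq_of_jointMoment_eq V fun U _ => by
    rw [jointMoment_const, jointMoment_const, hψ]

theorem twoStateCumulant_eq_of_moments_eq {φ ψ : A →ₗ[ℂ] ℂ} {X Y : A}
    (hφ : ∀ n : ℕ, φ (X ^ n) = φ (Y ^ n)) (hψ : ∀ n : ℕ, ψ (X ^ n) = ψ (Y ^ n)) (V : Finset ℕ) :
    twoStateCumulant φ ψ (fun _ => Y) V = twoStateCumulant φ ψ (fun _ => X) V :=
  twoStateCumulant_eq_of_jointMoment_eq V
    (fun U _ => by rw [jointMoment_const, jointMoment_const, hφ])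
    (fun U _ => by rw [jointMoment_const, jointMoment_const, hψ])

end CumulantLemmas

/-! ### Sums over the elements of a finite set by their rank -/

theorem card_filter_gt {t : Finset ℕ} {j : ℕ} (hj : j ∈ t) :
    (t.filter (j < ·)).card = t.card - 1 - (t.filter (· < j)).card := by
  have h : t = insert j (t.filter (· < j) ∪ t.filter (j < ·)) := by
    ext k
    simp only [Finset.mem_insert, Finset.mem_union, Finset.mem_filter]
    rcases lt_trichotomy k j with h | h | h
    · simp [h, h.ne, h.le]
    · simp [h, hj]
    · simp [h, h.ne', h.le]
  have h1 : t.card = (t.filter (· < j)).card + (t.filter (j < ·)).card + 1 := by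
    conv_lhs => rw [h]
    rw [Finset.card_insert_of_notMem (by simp), Finset.card_union_of_disjoint]
    rw [Finset.disjoint_left]
    intro k h1 h2
    exact lt_asymm (Finset.mem_filter.1 h1).2 (Finset.mem_filter.1 h2).2
  omega

theorem sum_card_filter_lt (t : Finset ℕ) (g : ℕ → ℂ) :
    ∑ j ∈ t, g (t.filter (· < j)).card = ∑ i ∈ Finset.range t.card, g i := by
  induction t using Finset.induction_on_max with
  | empty => simp
  | insert a s ha ih =>
    have hn : a ∉ s := fun h => lt_irrefl _ (ha a h)
    rw [Finset.sum_insert hn, Finset.card_insert_of_notMem hn, Finset.sum_range_succ, ← ih,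
      add_comm]
    congr 1
    · refine Finset.sum_congr rfl fun j hj => ?_
      rw [Finset.filter_insert, if_neg (not_lt.2 (ha j hj).le)]
    · rw [Finset.filter_insert, if_neg (lt_irrefl _), Finset.filter_true_of_mem ha]

theorem sum_card_filter (t : Finset ℕ) (h : ℕ → ℕ → ℂ) :
    ∑ j ∈ t, h (t.filter (· < j)).card (t.filter (j < ·)).card =
      ∑ i ∈ Finset.range t.card, h i (t.card - 1 - i) := by
  rw [← sum_card_filter_lt t fun i => h i (t.card - 1 - i)]
  exact Finset.sum_congr rfl fun j hj => by rw [card_filter_gt hj]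

/-! ### The first two elements of the first block -/

section SumOfFreeElements

variable {A : Type*} [Ring A] [Algebra ℂ A] {φ ψ : A →ₗ[ℂ] ℂ} {X Y : A}

theorem twoStateCumulant_add (hfree : IsTwoStateFree φ ψ X Y)
    (hφXY : ∀ n : ℕ, φ (X ^ n) = φ (Y ^ n)) (hψXY : ∀ n : ℕ, ψ (X ^ n) = ψ (Y ^ n))
    {V : Finset ℕ} (hV : V.Nonempty) :
    twoStateCumulant φ ψ (fun _ => X + Y) V = 2 * twoStateCumulant φ ψ (fun _ => X) V := by
  have h := twoStateCumulant_combination hfree hV (fun _ => 1) (fun _ => 1)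
  simp only [one_smul, Finset.prod_const_one, one_mul,
    twoStateCumulant_eq_of_moments_eq hφXY hψXY] at h
  rw [h, two_mul]

theorem freeCumulant_add (hfree : IsFreePair ψ X Y)
    (hψXY : ∀ n : ℕ, ψ (X ^ n) = ψ (Y ^ n)) {V : Finset ℕ} (hV : V.Nonempty) :
    freeCumulant ψ (fun _ => X + Y) V = 2 * freeCumulant ψ (fun _ => X) V := by
  have h := freeCumulant_combination hfree hV (fun _ => 1) (fun _ => 1)
  simp only [one_smul, Finset.prod_const_one, one_mul, freeCumulant_eq_of_moments_eq hψXY] at h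
  rw [h, two_mul]

/-- The cumulants of words in `X - Y` (on `K`) and `X + Y` (off `K`). -/
theorem twoStateCumulant_sub_add (hfree : IsTwoStateFree φ ψ X Y)
    (hφXY : ∀ n : ℕ, φ (X ^ n) = φ (Y ^ n)) (hψXY : ∀ n : ℕ, ψ (X ^ n) = ψ (Y ^ n))
    (K : Finset ℕ) {V : Finset ℕ} (hV : V.Nonempty) :
    twoStateCumulant φ ψ (fun i => if i ∈ K then X - Y else X + Y) V =
      (1 + (-1) ^ (V ∩ K).card) * twoStateCumulant φ ψ (fun _ => X) V := by
  have h := twoStateCumulant_combination hfree hV (fun _ => 1) (fun i => if i ∈ K then -1 else 1)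
  rw [twoStateCumulant_eq_of_moments_eq hφXY hψXY, Finset.prod_const_one, Finset.prod_ite,
    Finset.prod_const_one, Finset.prod_const, mul_one, ← add_mul,
    Finset.filter_mem_eq_inter] at h
  rw [← h]
  congr 1
  funext i
  split_ifs <;> simp [sub_eq_add_neg]

/-- The partitions in which the first two elements lie in the same block. -/
theorem ncSumOver_pair_eq (hφ : φ 1 = 1) (hfree : IsTwoStateFree φ ψ X Y)
    (hφXY : ∀ n : ℕ, φ (X ^ n) = φ (Y ^ n)) (hψXY : ∀ n : ℕ, ψ (X ^ n) = ψ (Y ^ n))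
    {a j : ℕ} (haj : a < j) {t : Finset ℕ} (ht : ∀ k ∈ t, j < k) :
    ncSumOver (twoStateCumulant φ ψ fun _ => X + Y) (freeCumulant ψ fun _ => X + Y)
      (insert j {a}) (insert j {a} ∪ t) = φ ((X - Y) ^ 2 * (X + Y) ^ t.card) := by
  have hs : (insert j {a} ∪ t : Finset ℕ) = insert a (insert j t) := by
    ext k; simp only [Finset.mem_union, Finset.mem_insert, Finset.mem_singleton]; tauto
  have hmin : ∀ k ∈ insert a (insert j t), a ≤ k := by
    intro k hk
    rcases Finset.mem_insert.1 hk with rfl | hk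
    · exact le_rfl
    rcases Finset.mem_insert.1 hk with rfl | hk
    · exact haj.le
    · exact (haj.trans (ht k hk)).le
  have hK : (insert j {a} : Finset ℕ) = {a, j} := Finset.pair_comm _ _
  rw [hs, hK]
  set K : Finset ℕ := {a, j} with hKdef
  set d : ℕ → A := fun i => if i ∈ K then X - Y else X + Y with hd
  have hcard : K.card = 2 := Finset.card_pair haj.ne
  -- Pass to the word `d`, with `X - Y` at `a` and `j`. A block through both has the same cumulant,
  -- since `1 + (-1)² = 2`. A block avoiding both sees only `X + Y`. A block with `a` but not `j`
  -- has cumulant zero, since `1 + (-1) = 0`, so the restricted sum is the full one, a moment.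
  rw [ncSumOver_congr (u' := twoStateCumulant φ ψ d) (v' := freeCumulant ψ d) (a := a)
    (by simp [hKdef]) hmin, ← ncSum_eq_ncSumOver_pair _ _ (Finset.mem_insert_self _ _) hmin,
    ncSum_twoStateCumulant hφ]
  · have hat : a ∉ insert j t := by
      intro h
      rcases Finset.mem_insert.1 h with rfl | h
      · exact lt_irrefl _ haj
      · exact lt_asymm haj (ht a h)
    have hjt : j ∉ t := fun h => lt_irrefl _ (ht j h)
    rw [jointMoment, Finset.sort_insert (r := (· ≤ ·))
      (fun b hb => hmin b (Finset.mem_insert_of_mem hb)) hat,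
      Finset.sort_insert (r := (· ≤ ·)) (fun b hb => (ht b hb).le) hjt, List.map_cons,
      List.map_cons, List.prod_cons, List.prod_cons, ← mul_assoc]
    have h1 : (t.sort (· ≤ ·)).map d = (t.sort (· ≤ ·)).map fun _ => X + Y := by
      refine List.map_congr_left fun k hk => ?_
      rw [Finset.mem_sort] at hk
      refine if_neg ?_
      rw [hKdef, Finset.mem_insert, Finset.mem_singleton]
      rintro (rfl | rfl)
      · exact hat (Finset.mem_insert_of_mem hk)
      · exact hjt hk
    rw [h1]
    simp [hd, hKdef, pow_two]
  · intro V _ haV hjV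
    rw [twoStateCumulant_sub_add hfree hφXY hψXY K ⟨a, haV⟩]
    have : V ∩ K = {a} := by
      ext k
      simp only [hKdef, Finset.mem_inter, Finset.mem_insert, Finset.mem_singleton]
      constructor
      · rintro ⟨h1, rfl | rfl⟩
        · rfl
        · exact absurd h1 hjV
      · rintro rfl
        exact ⟨haV, Or.inl rfl⟩
    rw [this]
    simp
  · intro V _ hKV
    have hne : V.Nonempty := ⟨a, hKV (by simp [hKdef])⟩
    rw [twoStateCumulant_sub_add hfree hφXY hψXY K hne, twoStateCumulant_add hfree hφXY hψXY hne,
      Finset.inter_eq_right.2 hKV, hcard]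
    norm_num
  · intro V _ _ hKV
    have : ∀ k ∈ V, X + Y = d k := fun k hk =>
      (if_neg (Finset.disjoint_right.1 hKV hk)).symm
    exact ⟨twoStateCumulant_congr φ ψ this, freeCumulant_congr ψ this⟩

theorem map_add_pow_add_two (hφ : φ 1 = 1) (hψ : ψ 1 = 1) (hfree : IsTwoStateFree φ ψ X Y)
    (hφXY : ∀ n : ℕ, φ (X ^ n) = φ (Y ^ n)) (hψXY : ∀ n : ℕ, ψ (X ^ n) = ψ (Y ^ n))
    (hmean : φ X = 0) (n : ℕ) :
    φ ((X + Y) ^ (n + 2)) = ∑ i ∈ Finset.range (n + 1),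
      ψ ((X + Y) ^ i) * φ ((X - Y) ^ 2 * (X + Y) ^ (n - i)) := by
  set u := twoStateCumulant φ ψ fun _ => X + Y with hu
  set v := freeCumulant ψ fun _ => X + Y with hv
  have hM : ∀ s, ncSum u v s = φ ((X + Y) ^ s.card) := fun s => by
    rw [ncSum_twoStateCumulant hφ, jointMoment_const]
  have hm : ∀ s, ncSum v v s = ψ ((X + Y) ^ s.card) := fun s => by
    rw [ncSum_freeCumulant hψ, jointMoment_const]
  -- The first cumulant is the mean, so partitions whose first block is a singleton contribute
  -- nothing.
  have hu0 : u {0} = 0 := by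
    have hY : φ Y = 0 := by simpa [hmean] using (hφXY 1).symm
    rw [← ncSumOver_self u v (Finset.singleton_nonempty 0),
      ← ncSum_eq_ncSumOver_singleton u v (Finset.mem_singleton_self 0), hM]
    simp [hmean, hY]
  set t := Finset.Ico 1 (n + 2) with ht
  have htc : t.card = n + 1 := by simp [ht]
  have hVt : ∀ a ∈ ({0} : Finset ℕ), ∀ b ∈ t, a < b := by
    intro a ha b hb
    rw [Finset.mem_singleton.1 ha]
    exact (Finset.mem_Ico.1 hb).1
  have hc : ({0} ∪ t : Finset ℕ).card = n + 2 := by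
    rw [Finset.card_union_of_disjoint, htc]
    · simp; omega
    · simp [ht]
  rw [← hc, ← hM, ncSum_eq_ncSumOver_singleton u v (a := 0) (by simp),
    ncSumOver_eq u v (Finset.singleton_nonempty 0) hVt, hu0, zero_mul, zero_add]
  rw [Finset.sum_congr rfl fun j hj => ?_, sum_card_filter t fun i k =>
    ψ ((X + Y) ^ i) * φ ((X - Y) ^ 2 * (X + Y) ^ k), htc]
  · rfl
  · rw [hm, ncSumOver_pair_eq hφ hfree hφXY hψXY (hVt 0 (by simp) j hj)
      fun k hk => (Finset.mem_filter.1 hk).2]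

end SumOfFreeElements

/-! ### Cumulants of a single element -/

/-- If the sums over `NC(s)` depend only on the size of `s`, then so do the weights, and the sums
over the noncrossing partitions of `V ∪ t`, `V < t`, with a block containing `V`. -/
theorem ncSumOver_eq_card {u v : Finset ℕ → ℂ} {M m : ℕ → ℂ} (hM : ∀ s, ncSum u v s = M s.card)
    (hm : ∀ s, ncSum v v s = m s.card) : ∃ F : ℕ → ℕ → ℂ, ∀ V t : Finset ℕ, V.Nonempty →
      (∀ a ∈ V, ∀ b ∈ t, a < b) → ncSumOver u v V (V ∪ t) = F V.card t.card := by
  have hm0 : m 0 = 1 := by rw [← Finset.card_empty, ← hm, ncSum_empty]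
  set F : ℕ → ℕ → ℂ := fun k n =>
    ncSumOver u v (Finset.range k) (Finset.range k ∪ Finset.Ico k (k + n)) with hF
  have hcan : ∀ k n, ∀ a ∈ Finset.range k, ∀ b ∈ Finset.Ico k (k + n), a < b := by
    intro k n a ha b hb
    rw [Finset.mem_range] at ha
    rw [Finset.mem_Ico] at hb
    omega
  refine ⟨F, ?_⟩
  -- Lexicographic induction on the number of points `N = k + n` and then on `k`. For `k = 1` the
  -- sum is an unrestricted one.
  suffices key : ∀ N k n, k + n = N → 0 < k → ∀ V t : Finset ℕ, V.card = k → t.card = n →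
      (∀ a ∈ V, ∀ b ∈ t, a < b) → ncSumOver u v V (V ∪ t) = F k n from
    fun V t hV hVt => key _ _ _ rfl hV.card_pos V t rfl rfl hVt
  intro N
  induction N using Nat.strong_induction_on with
  | _ N IH =>
  intro k
  induction k with
  | zero => intro n _ h; exact absurd h (lt_irrefl _)
  | succ k ihk =>
  intro n hN _ V t hV ht hVt
  rcases Nat.eq_zero_or_pos k with rfl | hk
  · have h1 : ∀ V t : Finset ℕ, V.card = 1 → t.card = n → (∀ a ∈ V, ∀ b ∈ t, a < b) →
        ncSumOver u v V (V ∪ t) = M (n + 1) := by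
      intro V t hV ht hVt
      obtain ⟨a, rfl⟩ := Finset.card_eq_one.1 hV
      rw [← ncSum_eq_ncSumOver_singleton u v (by simp), hM, Finset.card_union_of_disjoint,
        ht, Finset.card_singleton, add_comm]
      rw [Finset.disjoint_left]
      exact fun x hx hxt => lt_irrefl _ (hVt x hx x hxt)
    rw [h1 V t hV ht hVt, hF]
    exact (h1 _ _ (by simp) (by simp) (hcan _ _)).symm
  -- Apply the recursion to `V` without its maximum `j`, with `j` moved into the second set. The
  -- summand at `j` is the sum sought, with factor `m 0 = 1`; all other terms are known by
  -- induction.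
  · have expr : ∀ V t : Finset ℕ, V.card = k + 1 → t.card = n → (∀ a ∈ V, ∀ b ∈ t, a < b) →
        ncSumOver u v V (V ∪ t) = F k (n + 1) - F k 0 * M (n + 1) -
          ∑ i ∈ Finset.range n, m (i + 1) * F (k + 1) (n - 1 - i) := by
      intro V t hV ht hVt
      have hne : V.Nonempty := Finset.card_pos.1 (by omega)
      set j := V.max' hne with hj
      have hjV : j ∈ V := V.max'_mem hne
      set V₀ := V.erase j with hV₀
      have hV₀c : V₀.card = k := by rw [hV₀, Finset.card_erase_of_mem hjV, hV]; rfl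
      have hV₀j : ∀ a ∈ V₀, a < j := fun a ha => V.lt_max'_of_mem_erase_max' hne ha
      have hV₀V : V₀ ⊆ V := Finset.erase_subset _ _
      have hins : insert j V₀ = V := Finset.insert_erase hjV
      have hjt : j ∉ t := fun h => lt_irrefl _ (hVt j hjV j h)
      have hV₀t : ∀ a ∈ V₀, ∀ b ∈ insert j t, a < b := by
        intro a ha b hb
        rcases Finset.mem_insert.1 hb with rfl | hb
        · exact hV₀j a ha
        · exact hVt a (hV₀V ha) b hb
      have htc : (insert j t).card = n + 1 := by rw [Finset.card_insert_of_notMem hjt, ht]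
      have hrec := ncSumOver_eq u v (Finset.card_pos.1 (by omega)) hV₀t
      have hfj : (insert j t).filter (· < j) = ∅ := by
        refine Finset.filter_eq_empty_iff.2 fun x hx => ?_
        rcases Finset.mem_insert.1 hx with rfl | hx
        · exact lt_irrefl _
        · exact (hVt j hjV x hx).le.not_gt
      have hfj' : (insert j t).filter (j < ·) = t := by
        rw [Finset.filter_insert, if_neg (lt_irrefl _),
          Finset.filter_true_of_mem fun x hx => hVt j hjV x hx]
      have hself : u V₀ = F k 0 := by
        rw [← IH k (by omega) k 0 rfl hk V₀ ∅ hV₀c rfl (by simp), Finset.union_empty,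
          ncSumOver_self u v (Finset.card_pos.1 (by omega))]
      rw [ihk (n + 1) (by omega) hk V₀ (insert j t) hV₀c htc hV₀t, hM, htc,
        Finset.sum_insert hjt, hfj, hfj', hm, Finset.card_empty, hm0, one_mul, hins, hself] at hrec
      rw [hrec, ← ht, ← sum_card_filter t fun i l => m (i + 1) * F (k + 1) l]
      have hsum : ∀ i ∈ t, ncSum v v ((insert j t).filter (· < i)) *
          ncSumOver u v (insert i V₀) (insert i V₀ ∪ (insert j t).filter (i < ·)) =
          -- The extra `1` counts `j`, which lies before `i` and now belongs to the inner part.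
          m ((t.filter (· < i)).card + 1) * F (k + 1) (t.filter (i < ·)).card := by
        intro i hi
        have hji := hVt j hjV i hi
        have hiV : i ∉ V₀ := fun h => lt_asymm hji (hV₀j i h)
        rw [hm, Finset.filter_insert, if_pos hji, Finset.filter_insert,
          if_neg hji.not_gt, Finset.card_insert_of_notMem fun h => hjt (Finset.mem_filter.1 h).1]
        congr 1
        have hlt : (t.filter (i < ·)).card < n := by
          rw [← ht]
          refine Finset.card_lt_card (Finset.filter_ssubset.2 ⟨i, hi, lt_irrefl _⟩)
        refine IH _ (by omega) (k + 1) _ rfl (by omega) _ _ ?_ rfl ?_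
        · rw [Finset.card_insert_of_notMem hiV, hV₀c]
        · intro a ha b hb
          rw [Finset.mem_filter] at hb
          rcases Finset.mem_insert.1 ha with rfl | ha
          · exact hb.2
          · exact hVt a (hV₀V ha) b hb.1
      rw [Finset.sum_congr rfl hsum]
      ring
    rw [expr V t hV ht hVt, hF]
    exact (expr _ _ (by simp) (by simp) (hcan _ _)).symm

/-- `F k n` is the sum over the partitions of `k + n` points whose first `k` points share a block.
In particular `F k 0` is the cumulant of order `k`. -/
theorem exists_block_expansion {u v : Finset ℕ → ℂ} {M m : ℕ → ℂ}
    (hM : ∀ s, ncSum u v s = M s.card) (hm : ∀ s, ncSum v v s = m s.card) :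
    ∃ F : ℕ → ℕ → ℂ, (∀ n, M (n + 1) = F 1 n) ∧ (∀ V : Finset ℕ, V.Nonempty → u V = F V.card 0) ∧
      ∀ k n, 0 < k → F k n =
        F k 0 * M n + ∑ i ∈ Finset.range n, m i * F (k + 1) (n - 1 - i) := by
  obtain ⟨F, hF⟩ := ncSumOver_eq_card hM hm
  have hself : ∀ V : Finset ℕ, V.Nonempty → u V = F V.card 0 := by
    intro V hV
    rw [← ncSumOver_self u v hV, ← Finset.card_empty, ← hF V ∅ hV (by simp), Finset.union_empty]
  have hcan : ∀ k n, ∀ a ∈ Finset.range k, ∀ b ∈ Finset.Ico k (k + n), a < b := by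
    intro k n a ha b hb
    rw [Finset.mem_range] at ha
    rw [Finset.mem_Ico] at hb
    omega
  refine ⟨F, fun n => ?_, hself, fun k n hk => ?_⟩
  · have h := hF {0} (Finset.Ico 1 (1 + n)) (by simp) (hcan 1 n)
    rw [← ncSum_eq_ncSumOver_singleton u v (by simp), hM, Finset.card_union_of_disjoint] at h
    · simpa [add_comm] using h
    · simp
  · have hne : (Finset.range k).Nonempty := Finset.nonempty_range_iff.2 hk.ne'
    have h := ncSumOver_eq u v hne (hcan k n)
    rw [hF _ _ hne (hcan k n), hself _ hne, hM, Finset.sum_congr rfl fun j hj => ?_,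
      sum_card_filter _ fun i l => m i * F (k + 1) l] at h
    · simpa using h
    · have hjk := (Finset.mem_Ico.1 hj).1
      rw [hm, hF _ _ (Finset.insert_nonempty _ _),
        Finset.card_insert_of_notMem (by simpa using hjk), Finset.card_range]
      intro a ha b hb
      rw [Finset.mem_filter] at hb
      rcases Finset.mem_insert.1 ha with rfl | ha
      · exact hb.2
      · exact hcan k n a ha b hb.1

/-! ### Moments and Jacobi parameters -/

/-- The coefficients of `x ^ n` in the basis of the polynomials `jacobiPoly β γ k`. -/
noncomputable def jacobiCoeff (β γ : ℕ → ℝ) : ℕ → ℕ → ℝ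
  | 0, 0 => 1
  | 0, _ + 1 => 0
  | n + 1, 0 => β 0 * jacobiCoeff β γ n 0 + γ 0 * jacobiCoeff β γ n 1
  | n + 1, k + 1 => jacobiCoeff β γ n k + β (k + 1) * jacobiCoeff β γ n (k + 1) +
      γ (k + 1) * jacobiCoeff β γ n (k + 2)

theorem jacobiCoeff_eq_zero (β γ : ℕ → ℝ) {n k : ℕ} (h : n < k) : jacobiCoeff β γ n k = 0 := by
  induction n generalizing k with
  | zero =>
    obtain ⟨k, rfl⟩ := Nat.exists_eq_add_of_lt h
    simp [jacobiCoeff]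
  | succ n ih =>
    obtain ⟨k, rfl⟩ : ∃ l, k = l + 1 := ⟨k - 1, by omega⟩
    rw [jacobiCoeff, ih (by omega), ih (by omega), ih (by omega)]
    ring

theorem jacobiCoeff_self (β γ : ℕ → ℝ) (n : ℕ) : jacobiCoeff β γ n n = 1 := by
  induction n with
  | zero => rw [jacobiCoeff]
  | succ n ih =>
    rw [jacobiCoeff, ih, jacobiCoeff_eq_zero _ _ (by omega), jacobiCoeff_eq_zero _ _ (by omega)]
    ring

theorem X_mul_jacobiPoly_zero (β γ : ℕ → ℝ) :
    Polynomial.X * jacobiPoly β γ 0 =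
      jacobiPoly β γ 1 + Polynomial.C (β 0) * jacobiPoly β γ 0 := by
  simp only [jacobiPoly]
  ring

theorem X_mul_jacobiPoly_succ (β γ : ℕ → ℝ) (n : ℕ) :
    Polynomial.X * jacobiPoly β γ (n + 1) = jacobiPoly β γ (n + 2) +
      Polynomial.C (β (n + 1)) * jacobiPoly β γ (n + 1) +
        Polynomial.C (γ n) * jacobiPoly β γ n := by
  rw [jacobiPoly]
  ring

theorem X_pow_eq_sum_jacobiPoly (β γ : ℕ → ℝ) (n : ℕ) {N : ℕ} (hN : n < N) :
    (Polynomial.X : Polynomial ℝ) ^ n =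
      ∑ k ∈ Finset.range N, Polynomial.C (jacobiCoeff β γ n k) * jacobiPoly β γ k := by
  induction n generalizing N with
  | zero =>
    obtain ⟨N, rfl⟩ : ∃ l, N = l + 1 := ⟨N - 1, by omega⟩
    rw [Finset.sum_range_succ', Finset.sum_eq_zero fun k _ => by simp [jacobiCoeff]]
    simp [jacobiCoeff, jacobiPoly]
  | succ n ih =>
    obtain ⟨N, rfl⟩ : ∃ l, N = l + 2 := ⟨N - 2, by omega⟩
    -- Summation by parts, with explicit boundary terms; they vanish for `L = N` because
    -- `jacobiCoeff β γ n k = 0` for `k > n`.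
    have key : ∀ L, (∑ k ∈ Finset.range (L + 1), Polynomial.C (jacobiCoeff β γ n k) *
        (Polynomial.X * jacobiPoly β γ k)) +
        (Polynomial.C (jacobiCoeff β γ n (L + 1)) * (Polynomial.C (γ L) * jacobiPoly β γ L)) +
        Polynomial.C (jacobiCoeff β γ n (L + 1)) *
          (Polynomial.C (β (L + 1)) * jacobiPoly β γ (L + 1)) +
        Polynomial.C (jacobiCoeff β γ n (L + 2)) *
          (Polynomial.C (γ (L + 1)) * jacobiPoly β γ (L + 1)) =
        ∑ k ∈ Finset.range (L + 2),
          Polynomial.C (jacobiCoeff β γ (n + 1) k) * jacobiPoly β γ k := by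
      intro L
      induction L with
      | zero =>
        simp only [Finset.sum_range_succ, Finset.sum_range_zero, X_mul_jacobiPoly_zero,
          jacobiCoeff, map_add, map_mul]
        ring
      | succ L ihL =>
        rw [Finset.sum_range_succ _ (L + 2), ← ihL, Finset.sum_range_succ _ (L + 1),
          X_mul_jacobiPoly_succ]
        simp only [jacobiCoeff, map_add, map_mul]
        ring
    rw [← key, pow_succ', ih (N := N + 1) (by omega), Finset.mul_sum,
      jacobiCoeff_eq_zero β γ (n := n) (k := N + 1) (by omega),
      jacobiCoeff_eq_zero β γ (n := n) (k := N + 2) (by omega)]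
    simp only [map_zero, zero_mul, add_zero]
    exact Finset.sum_congr rfl fun k _ => by ring

theorem apply_X_pow_eq_jacobiCoeff {β γ : ℕ → ℝ} {L : Polynomial ℝ →ₗ[ℝ] ℝ} (h1 : L 1 = 1)
    (h : ∀ k, L (jacobiPoly β γ (k + 1)) = 0) (n : ℕ) :
    L (Polynomial.X ^ n) = jacobiCoeff β γ n 0 := by
  rw [X_pow_eq_sum_jacobiPoly β γ n (Nat.lt_succ_self n), map_sum, Finset.sum_range_succ',
    Finset.sum_eq_zero fun k _ => ?_]
  · rw [← Polynomial.smul_eq_C_mul, map_smul, jacobiPoly, h1]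
    simp
  · rw [← Polynomial.smul_eq_C_mul, map_smul, h, smul_zero]

/-- Since the leading coefficient is `1`, `L` of `X ^ (k + 1)` is `L` of the next polynomial plus
the coefficient at level `0`; the intermediate terms vanish by induction. -/
theorem apply_jacobiPoly_succ_eq_zero {β γ : ℕ → ℝ} {L : Polynomial ℝ →ₗ[ℝ] ℝ}
    (h : ∀ n, L (Polynomial.X ^ n) = jacobiCoeff β γ n 0) (k : ℕ) :
    L (jacobiPoly β γ (k + 1)) = 0 := by
  induction k using Nat.strong_induction_on with
  | _ k ih =>
    have h1 : L 1 = 1 := by simpa [jacobiCoeff] using h 0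
    have e := h (k + 1)
    rw [X_pow_eq_sum_jacobiPoly β γ (k + 1) (Nat.lt_succ_self _), map_sum, Finset.sum_range_succ,
      Finset.sum_range_succ', Finset.sum_eq_zero fun l hl => ?_] at e
    · simp only [← Polynomial.smul_eq_C_mul, map_smul, jacobiCoeff_self, jacobiPoly, h1] at e
      simpa using e
    · rw [← Polynomial.smul_eq_C_mul, map_smul, ih l (Finset.mem_range.1 hl), smul_zero]

/-- The recurrence moves a factor `X` from the polynomial of lower degree to the other one. Each
resulting product has a smaller lower index, still strictly below the higher one. -/
theorem apply_jacobiPoly_mul_eq_zero {β γ : ℕ → ℝ} {L : Polynomial ℝ →ₗ[ℝ] ℝ}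
    (h : ∀ k, L (jacobiPoly β γ (k + 1)) = 0) (m : ℕ) : ∀ n, m < n →
    L (jacobiPoly β γ m * jacobiPoly β γ n) = 0 := by
  induction m using Nat.strong_induction_on with
  | _ m ih =>
    intro n hn
    obtain ⟨n, rfl⟩ : ∃ l, n = l + 1 := ⟨n - 1, by omega⟩
    match m, ih, hn with
    | 0, _, _ => rw [jacobiPoly, one_mul, h]
    | 1, ih, hn =>
      obtain ⟨n, rfl⟩ : ∃ l, n = l + 1 := ⟨n - 1, by omega⟩
      have e : jacobiPoly β γ 1 * jacobiPoly β γ (n + 1 + 1) =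
          jacobiPoly β γ (n + 3) + β (n + 2) • jacobiPoly β γ (n + 2) +
            γ (n + 1) • jacobiPoly β γ (n + 1) - β 0 • jacobiPoly β γ (n + 2) := by
        simp only [Polynomial.smul_eq_C_mul]
        rw [← X_mul_jacobiPoly_succ β γ (n + 1)]
        simp only [jacobiPoly]
        ring
      rw [e, map_sub, map_add, map_add, map_smul, map_smul, map_smul, h, h, h]
      simp
    | m + 2, ih, hn =>
      obtain ⟨n, rfl⟩ : ∃ l, n = l + 1 := ⟨n - 1, by omega⟩
      have e : jacobiPoly β γ (m + 2) * jacobiPoly β γ (n + 1 + 1) =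
          jacobiPoly β γ (m + 1) * jacobiPoly β γ (n + 3) +
            β (n + 2) • (jacobiPoly β γ (m + 1) * jacobiPoly β γ (n + 2)) +
            γ (n + 1) • (jacobiPoly β γ (m + 1) * jacobiPoly β γ (n + 1)) -
            β (m + 1) • (jacobiPoly β γ (m + 1) * jacobiPoly β γ (n + 2)) -
            γ m • (jacobiPoly β γ m * jacobiPoly β γ (n + 2)) := by
        simp only [Polynomial.smul_eq_C_mul]
        have := X_mul_jacobiPoly_succ β γ (n + 1)
        rw [show jacobiPoly β γ (m + 2) = (Polynomial.X - Polynomial.C (β (m + 1))) *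
          jacobiPoly β γ (m + 1) - Polynomial.C (γ m) * jacobiPoly β γ m by rw [jacobiPoly]]
        linear_combination jacobiPoly β γ (m + 1) * this
      rw [e, map_sub, map_sub, map_add, map_add, map_smul, map_smul, map_smul, map_smul,
        ih (m + 1) (by omega) _ (by omega), ih (m + 1) (by omega) _ (by omega),
        ih (m + 1) (by omega) _ (by omega), ih m (by omega) _ (by omega)]
      simp

section Measures

open MeasureTheory

variable {μ : Measure ℝ}

theorem integrable_polynomial_eval (h : ∀ n : ℕ, Integrable (fun x : ℝ => x ^ n) μ)
    (p : Polynomial ℝ) : Integrable (fun x => p.eval x) μ := by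
  simp only [Polynomial.eval_eq_sum_range]
  exact integrable_finsetSum _ fun i _ => (h i).const_mul _

/-- The moment functional of a measure with finite moments. -/
noncomputable def momentFunctional (h : ∀ n : ℕ, Integrable (fun x : ℝ => x ^ n) μ) :
    Polynomial ℝ →ₗ[ℝ] ℝ where
  toFun p := ∫ x, p.eval x ∂μ
  map_add' p q := by
    simp only [Polynomial.eval_add]
    exact integral_add (integrable_polynomial_eval h p) (integrable_polynomial_eval h q)
  map_smul' r p := by
    simp only [Polynomial.eval_smul, smul_eq_mul, RingHom.id_apply]
    exact integral_const_mul r _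

theorem HasJacobiParameters.moment_eq [IsProbabilityMeasure μ] {β γ : ℕ → ℝ}
    (h : HasJacobiParameters μ β γ) (n : ℕ) : ∫ x, x ^ n ∂μ = jacobiCoeff β γ n 0 := by
  have := apply_X_pow_eq_jacobiCoeff (β := β) (γ := γ) (L := momentFunctional h.integrable)
    (by simp [momentFunctional]) (fun k => by
      have := h.orthogonal 0 (k + 1) (by omega)
      simpa [momentFunctional, jacobiPoly] using this) n
  simpa [momentFunctional] using this

theorem hasJacobiParameters_of_moment_eq {β γ : ℕ → ℝ}
    (hint : ∀ n : ℕ, Integrable (fun x : ℝ => x ^ n) μ) (hγ : ∀ n, 0 ≤ γ n)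
    (h : ∀ n : ℕ, ∫ x, x ^ n ∂μ = jacobiCoeff β γ n 0) : HasJacobiParameters μ β γ := by
  have h1 := apply_jacobiPoly_succ_eq_zero (β := β) (γ := γ) (L := momentFunctional hint)
    (fun n => by simpa [momentFunctional] using h n)
  refine ⟨hint, hγ, fun m n hmn => ?_⟩
  have key : ∀ m n, m < n →
      ∫ x, (jacobiPoly β γ m).eval x * (jacobiPoly β γ n).eval x ∂μ = 0 := by
    intro m n hlt
    simpa [momentFunctional] using apply_jacobiPoly_mul_eq_zero h1 m n hlt
  rcases hmn.lt_or_gt with hlt | hlt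
  · exact key m n hlt
  · simpa only [mul_comm] using key n m hlt

end Measures

/-! ### The continued fraction -/

section ContinuedFraction

open PowerSeries

/-- The generating series of the coefficients of the polynomial `jacobiPoly β γ k` in `x ^ n`. -/
noncomputable def jacobiSeries (β γ : ℕ → ℝ) (k : ℕ) : PowerSeries ℂ :=
  PowerSeries.mk fun n => (jacobiCoeff β γ n k : ℂ)

theorem jacobiSeries_zero (β γ : ℕ → ℝ) : jacobiSeries β γ 0 =
    1 + X * (C (β 0 : ℂ) * jacobiSeries β γ 0 + C (γ 0 : ℂ) * jacobiSeries β γ 1) := by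
  ext n
  cases n with
  | zero => simp [jacobiSeries, jacobiCoeff]
  | succ n =>
    rw [map_add, coeff_succ_X_mul]
    simp [jacobiSeries, jacobiCoeff, coeff_one]

theorem jacobiSeries_succ (β γ : ℕ → ℝ) (k : ℕ) : jacobiSeries β γ (k + 1) =
    X * (jacobiSeries β γ k + C (β (k + 1) : ℂ) * jacobiSeries β γ (k + 1) +
      C (γ (k + 1) : ℂ) * jacobiSeries β γ (k + 2)) := by
  ext n
  cases n with
  | zero => simp [jacobiSeries, jacobiCoeff]
  | succ n =>
    rw [coeff_succ_X_mul]
    simp [jacobiSeries, jacobiCoeff]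

/-- Decomposition at the last passage through the level `0`. -/
theorem jacobiSeries_succ_eq_mul (β γ : ℕ → ℝ) (k : ℕ) : jacobiSeries β γ (k + 1) =
    X * jacobiSeries β γ 0 * jacobiSeries (fun n => β (n + 1)) (fun n => γ (n + 1)) k := by
  set W := jacobiSeries (fun n => β (n + 1)) (fun n => γ (n + 1)) with hW
  ext n
  -- Both sides satisfy the same recursion in `k`, which carries a factor `X`; so the coefficients
  -- of order `n` for all `k` determine those of order `n + 1`.
  induction n generalizing k with
  | zero => simp [jacobiSeries, jacobiCoeff, mul_assoc]
  | succ n ih =>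
    cases k with
    | zero =>
      have e : X * jacobiSeries β γ 0 * W 0 = X * (jacobiSeries β γ 0 +
          C (β 1 : ℂ) * (X * jacobiSeries β γ 0 * W 0) +
          C (γ 1 : ℂ) * (X * jacobiSeries β γ 0 * W 1)) := by
        have h0 : W 0 = 1 + X * (C (β 1 : ℂ) * W 0 + C (γ 1 : ℂ) * W 1) := jacobiSeries_zero _ _
        linear_combination X * jacobiSeries β γ 0 * h0
      rw [e, jacobiSeries_succ, coeff_succ_X_mul, coeff_succ_X_mul]
      simp only [map_add, coeff_C_mul, ih]
    | succ k =>
      have e : X * jacobiSeries β γ 0 * W (k + 1) = X * ((X * jacobiSeries β γ 0 * W k) +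
          C (β (k + 2) : ℂ) * (X * jacobiSeries β γ 0 * W (k + 1)) +
          C (γ (k + 2) : ℂ) * (X * jacobiSeries β γ 0 * W (k + 2))) := by
        conv_lhs => rw [hW, jacobiSeries_succ, ← hW]
        ring
      rw [e, jacobiSeries_succ, coeff_succ_X_mul, coeff_succ_X_mul]
      simp only [map_add, coeff_C_mul, ih]

theorem jacobiSeries_continuedFraction (β γ : ℕ → ℝ) : jacobiSeries β γ 0 =
    1 + C (β 0 : ℂ) * X * jacobiSeries β γ 0 + C (γ 0 : ℂ) * X ^ 2 * jacobiSeries β γ 0 *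
      jacobiSeries (fun n => β (n + 1)) (fun n => γ (n + 1)) 0 := by
  conv_lhs => rw [jacobiSeries_zero, jacobiSeries_succ_eq_mul β γ 0]
  ring

theorem jacobiSeries_consSeq (β γ : ℕ → ℝ) (x y : ℝ) :
    jacobiSeries (consSeq x β) (consSeq y γ) 0 =
      1 + C (x : ℂ) * X * jacobiSeries (consSeq x β) (consSeq y γ) 0 +
        C (y : ℂ) * X ^ 2 * jacobiSeries (consSeq x β) (consSeq y γ) 0 * jacobiSeries β γ 0 :=
  jacobiSeries_continuedFraction (consSeq x β) (consSeq y γ)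

end ContinuedFraction

/-! ### Cumulant series -/

section CumulantSeries

open PowerSeries

/-- Iteration shows that `e k` is divisible by every power of `X`. -/
theorem eq_zero_of_eq_X_mul {e : ℕ → PowerSeries ℂ} {m : PowerSeries ℂ}
    (h : ∀ k, e k = X * m * e (k + 1)) (k : ℕ) : e k = 0 := by
  have key : ∀ n k, coeff n (e k) = 0 := by
    intro n
    induction n using Nat.strong_induction_on with
    | _ n ih =>
      intro k
      rw [h k, mul_assoc]
      cases n with
      | zero => simp
      | succ n =>
        rw [coeff_succ_X_mul, coeff_mul]
        refine Finset.sum_eq_zero fun p hp => ?_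
        rw [ih p.2 (by have := Finset.HasAntidiagonal.mem_antidiagonal.1 hp; omega), mul_zero]
  ext n
  rw [key, map_zero]

theorem hasSubst_X_mul (m : PowerSeries ℂ) : HasSubst (X * m) :=
  HasSubst.of_constantCoeff_zero' (by simp)

theorem eq_C_add_X_mul_mk (R : ℕ → ℂ) :
    PowerSeries.mk R = C (R 0) + X * PowerSeries.mk fun n => R (n + 1) := by
  ext n
  cases n with
  | zero => simp
  | succ n =>
    rw [map_add, coeff_succ_X_mul]
    simp

theorem C_subst (r : ℂ) (w : PowerSeries ℂ) : (C r).subst w = C r :=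
  PowerSeries.subst_C r

/-- The functional equation `M(z) = 1 + z M(z) T(z m(z))` between moment series and cumulant
series, in terms of the expansion of the first block. -/
theorem moment_series_eq {M m : ℕ → ℂ} {F : ℕ → ℕ → ℂ} (hM0 : M 0 = 1)
    (hM : ∀ n, M (n + 1) = F 1 n)
    (hF : ∀ k n, 0 < k → F k n =
      F k 0 * M n + ∑ i ∈ Finset.range n, m i * F (k + 1) (n - 1 - i)) :
    PowerSeries.mk M = 1 + X * PowerSeries.mk M *
      (PowerSeries.mk fun n => F (n + 1) 0).subst (X * PowerSeries.mk m) := by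
  have hw := hasSubst_X_mul (PowerSeries.mk m)
  have hrec : ∀ k, 0 < k → PowerSeries.mk (F k) =
      C (F k 0) * PowerSeries.mk M + X * PowerSeries.mk m * PowerSeries.mk (F (k + 1)) := by
    intro k hk
    ext n
    rw [coeff_mk, hF k n hk, map_add, coeff_C_mul, coeff_mk, mul_assoc]
    congr 1
    cases n with
    | zero => simp
    | succ n =>
      rw [coeff_succ_X_mul, coeff_mul, Finset.Nat.sum_antidiagonal_eq_sum_range_succ_mk]
      simp
  -- Iterating `hrec` suggests that the series of `F (k + 1)` is `M` times the cumulant series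
  -- shifted by `k`, evaluated at `z m(z)`. The difference of the two satisfies `e k = z m e (k +
  -- 1)`.
  have h0 := eq_zero_of_eq_X_mul (m := PowerSeries.mk m)
    (e := fun k => PowerSeries.mk (F (k + 1)) - PowerSeries.mk M *
      (PowerSeries.mk fun n => F (n + 1 + k) 0).subst (X * PowerSeries.mk m)) (fun k => by
      have hT := congrArg (fun f => f.subst (X * PowerSeries.mk m))
        (eq_C_add_X_mul_mk fun n => F (n + 1 + k) 0)
      simp only [subst_add hw, subst_mul hw, subst_X hw, C_subst] at hT
      rw [hT, hrec (k + 1) (Nat.succ_pos k)]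
      simp only [show ∀ n, n + 1 + 1 + k = n + 1 + (k + 1) by intro n; ring,
        show 0 + 1 + k = k + 1 by ring]
      ring) 0
  have h1 : PowerSeries.mk M = 1 + X * PowerSeries.mk (F 1) := by
    rw [eq_C_add_X_mul_mk M, hM0]
    simp [hM]
  simp only [add_zero, zero_add] at h0
  rw [mul_assoc, ← sub_eq_zero.1 h0, ← h1]

/-- If `f = zᵏ g` with `g(0) ≠ 0`, then `f(zm) = (zm)ᵏ g(zm)`, and `g(zm)` has constant term `g(0)`.
-/
theorem eq_zero_of_subst_eq_zero {f m : PowerSeries ℂ} (hm : constantCoeff m = 1)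
    (h : f.subst (X * m) = 0) : f = 0 := by
  by_contra hf
  have hw := hasSubst_X_mul m
  have hm0 : m ≠ 0 := by
    rintro rfl
    simp at hm
  obtain ⟨g, hg, hg0⟩ : ∃ g, f = X ^ f.order.toNat * g ∧ constantCoeff g ≠ 0 :=
    ⟨divXPowOrder f, X_pow_order_mul_divXPowOrder.symm, by
      rw [constantCoeff_divXPowOrder]
      exact coeff_order hf⟩
  rw [hg, subst_mul hw, subst_pow hw, subst_X hw] at h
  have hz : g.subst (X * m) = 0 :=
    (mul_eq_zero.1 h).resolve_left (pow_ne_zero _ (mul_ne_zero X_ne_zero hm0))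
  apply hg0
  rw [eq_X_mul_shift_add_const g, subst_add hw, subst_mul hw, subst_X hw, C_subst] at hz
  have := congrArg constantCoeff hz
  simpa using this

theorem ne_zero_of_constantCoeff_ne_zero {f : PowerSeries ℂ} (h : constantCoeff f ≠ 0) :
    f ≠ 0 := by
  rintro rfl
  exact h (map_zero _)

end CumulantSeries

/-! ### The moment series of the sum and of the summands -/

section MomentSeries

open PowerSeries

variable {A : Type*} [Ring A] [Algebra ℂ A]

/-- The moment series of `x`. -/
noncomputable def momentSeries (φ : A →ₗ[ℂ] ℂ) (x : A) : PowerSeries ℂ :=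
  PowerSeries.mk fun n => φ (x ^ n)

theorem constantCoeff_momentSeries {φ : A →ₗ[ℂ] ℂ} (hφ : φ 1 = 1) (x : A) :
    constantCoeff (momentSeries φ x) = 1 := by
  rw [momentSeries, ← coeff_zero_eq_constantCoeff_apply, coeff_mk, pow_zero, hφ]

theorem momentSeries_eq_X_mul {φ : A →ₗ[ℂ] ℂ} (hφ : φ 1 = 1) (x : A) :
    momentSeries φ x = 1 + X * PowerSeries.mk fun n => φ (x ^ (n + 1)) := by
  rw [momentSeries, eq_C_add_X_mul_mk, pow_zero, hφ, map_one]

/-- The two-state free cumulants of a single element. -/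
theorem exists_twoStateCumulant_series {φ ψ : A →ₗ[ℂ] ℂ} (hφ : φ 1 = 1) (hψ : ψ 1 = 1) (x : A) :
    ∃ R : ℕ → ℂ, (∀ V : Finset ℕ, V.Nonempty →
        twoStateCumulant φ ψ (fun _ => x) V = R V.card) ∧
      momentSeries φ x = 1 + X * momentSeries φ x *
        (PowerSeries.mk fun n => R (n + 1)).subst (X * momentSeries ψ x) := by
  obtain ⟨F, hM, hu, hF⟩ := exists_block_expansion
    (M := fun n => φ (x ^ n)) (m := fun n => ψ (x ^ n))
    (fun s => (ncSum_twoStateCumulant hφ ψ (fun _ => x) s).trans (jointMoment_const φ x s))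
    (fun s => (ncSum_freeCumulant hψ (fun _ => x) s).trans (jointMoment_const ψ x s))
  exact ⟨fun k => F k 0, hu, moment_series_eq (by simp [hφ]) hM hF⟩

/-- The free cumulants of a single element. -/
theorem exists_freeCumulant_series {ψ : A →ₗ[ℂ] ℂ} (hψ : ψ 1 = 1) (x : A) :
    ∃ r : ℕ → ℂ, (∀ V : Finset ℕ, V.Nonempty → freeCumulant ψ (fun _ => x) V = r V.card) ∧
      momentSeries ψ x = 1 + X * momentSeries ψ x *
        (PowerSeries.mk fun n => r (n + 1)).subst (X * momentSeries ψ x) := by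
  have h := fun s => (ncSum_freeCumulant hψ (fun _ => x) s).trans (jointMoment_const ψ x s)
  obtain ⟨F, hM, hu, hF⟩ := exists_block_expansion
    (M := fun n => ψ (x ^ n)) (m := fun n => ψ (x ^ n)) h h
  exact ⟨fun k => F k 0, hu, moment_series_eq (by simp [hψ]) hM hF⟩

variable {φ ψ : A →ₗ[ℂ] ℂ} {X Y : A}

/-- The functional equation for the sum, from the regression condition. -/
theorem momentSeries_add_eq (hφ : φ 1 = 1) (hψ : ψ 1 = 1)
    (hfree : IsTwoStateFree φ ψ X Y)
    (hφXY : ∀ n : ℕ, φ (X ^ n) = φ (Y ^ n)) (hψXY : ∀ n : ℕ, ψ (X ^ n) = ψ (Y ^ n))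
    (hmean : φ X = 0) (hvar : φ (X ^ 2) = 1) (b K c : ℝ)
    (hreg : ∀ n : ℕ, φ ((X - Y) ^ 2 * (X + Y) ^ n) =
      (K : ℂ) * φ (((4 : ℂ) • (1 : A) + ((2 * b : ℝ) : ℂ) • (X + Y) + (c : ℂ) • (X + Y) ^ 2) *
        (X + Y) ^ n)) :
    C (2 + c : ℂ) * (momentSeries φ (X + Y) - 1) = momentSeries ψ (X + Y) *
      (4 * PowerSeries.X ^ 2 * momentSeries φ (X + Y) +
        (C (2 * b : ℂ) * PowerSeries.X + C (c : ℂ)) * (momentSeries φ (X + Y) - 1)) := by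
  set S := X + Y with hS
  have hY : φ Y = 0 := by simpa [hmean] using (hφXY 1).symm
  have hS1 : φ S = 0 := by rw [hS, map_add, hmean, hY, add_zero]
  have hrec := map_add_pow_add_two hφ hψ hfree hφXY hψXY hmean
  rw [← hS] at hrec
  have hD : φ ((X - Y) ^ 2) = φ (S ^ 2) := by simpa [hψ] using (hrec 0).symm
  -- The recursion at `n = 0` gives `φ((X - Y)²) = φ(S²)`, and the two add up to `2φ(X²) + 2φ(Y²) =
  -- 4`.
  have hS2 : φ (S ^ 2) = 2 := by
    have e : S ^ 2 + (X - Y) ^ 2 = (2 : ℂ) • X ^ 2 + (2 : ℂ) • Y ^ 2 := by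
      rw [hS, two_smul, two_smul]
      noncomm_ring
    have := congrArg φ e
    rw [map_add, map_add, map_smul, map_smul, hD, ← hφXY, hvar, smul_eq_mul] at this
    linear_combination this / 2
  have hreg' : ∀ n, φ ((X - Y) ^ 2 * S ^ n) =
      K * (4 * φ (S ^ n) + 2 * b * φ (S ^ (n + 1)) + c * φ (S ^ (n + 2))) := by
    intro n
    rw [hreg n]
    simp only [add_mul, smul_mul_assoc, one_mul, map_add, map_smul, smul_eq_mul, ← pow_succ',
      ← pow_add]
    rw [add_comm 2 n]
    push_cast
    ring
  -- The regression condition at `n = 0` fixes the constant: `2 = K(4 + 2c)`.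
  have hK : (K : ℂ) * (2 + c) = 1 := by
    have := hreg' 0
    rw [pow_zero, mul_one, hD, hφ, zero_add, zero_add, pow_one, hS1, hS2] at this
    linear_combination -this / 2
  set M := momentSeries φ S
  set m := momentSeries ψ S
  set M₁ := PowerSeries.mk fun n => φ (S ^ (n + 1)) with hM₁
  set M₂ := PowerSeries.mk fun n => φ (S ^ (n + 2)) with hM₂
  set D := PowerSeries.mk fun n => φ ((X - Y) ^ 2 * S ^ n)
  have e1 : M = 1 + PowerSeries.X * M₁ := momentSeries_eq_X_mul hφ S
  have e2 : M₁ = PowerSeries.X * M₂ := by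
    rw [hM₁, eq_C_add_X_mul_mk, zero_add, pow_one, hS1, map_zero, zero_add]
  have e3 : M₂ = m * D := by
    ext n
    rw [coeff_mk, coeff_mul, hrec, Finset.Nat.sum_antidiagonal_eq_sum_range_succ_mk]
    exact Finset.sum_congr rfl fun i _ => by simp [m, D, momentSeries]
  have e4 : D = C (K : ℂ) * (4 * M + C (2 * b : ℂ) * M₁ + C (c : ℂ) * M₂) := by
    ext n
    rw [coeff_mk, hreg', coeff_C_mul, map_add, map_add, coeff_C_mul, coeff_C_mul,
      show (4 : PowerSeries ℂ) = C (4 : ℂ) from (map_ofNat C 4).symm, coeff_C_mul]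
    simp [M, M₁, M₂, momentSeries]
  have hK' : C (K : ℂ) * C (2 + c : ℂ) = 1 := by rw [← map_mul, hK, map_one]
  linear_combination (C (2 + c : ℂ) - m * (C (2 * b : ℂ) * PowerSeries.X + C (c : ℂ))) *
    (e1 + PowerSeries.X * e2) + C (2 + c : ℂ) * PowerSeries.X ^ 2 * (e3 + m * e4) +
    PowerSeries.X ^ 2 * m * (4 * M + C (2 * b : ℂ) * M₁ + C (c : ℂ) * M₂) * hK' +
    PowerSeries.X ^ 2 * m * C (2 * b : ℂ) * e2

end MomentSeries

/-! ### Passage from the functional equation of the sum to that of a summand. -/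

section SummandSeries

open PowerSeries

variable {A : Type*} [Ring A] [Algebra ℂ A] {φ ψ : A →ₗ[ℂ] ℂ} {X Y : A}

/-- The functional equation of the sum gives a functional equation of the summands. -/
theorem momentSeries_summand_eq (hφ : φ 1 = 1) (hψ : ψ 1 = 1)
    (hfree : IsTwoStateFree φ ψ X Y) (hfree' : IsFreePair ψ X Y)
    (hφXY : ∀ n : ℕ, φ (X ^ n) = φ (Y ^ n)) (hψXY : ∀ n : ℕ, ψ (X ^ n) = ψ (Y ^ n)) {b c : ℂ}
    (h : C (2 + c) * (momentSeries φ (X + Y) - 1) = momentSeries ψ (X + Y) *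
      (4 * PowerSeries.X ^ 2 * momentSeries φ (X + Y) +
        (C (2 * b) * PowerSeries.X + C c) * (momentSeries φ (X + Y) - 1))) :
    (momentSeries φ X - 1) * (C (1 + c) - momentSeries ψ X * (C b * PowerSeries.X + C c)) =
      PowerSeries.X ^ 2 * momentSeries ψ X * momentSeries φ X := by
  obtain ⟨R, hR, hRX⟩ := exists_twoStateCumulant_series (φ := φ) hφ hψ X
  obtain ⟨r, hr, hrX⟩ := exists_freeCumulant_series hψ X
  obtain ⟨R', hR', hRS⟩ := exists_twoStateCumulant_series (φ := φ) hφ hψ (X + Y)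
  obtain ⟨r', hr', hrS⟩ := exists_freeCumulant_series hψ (X + Y)
  have hne : ∀ n, (Finset.range (n + 1)).Nonempty := fun n => Finset.nonempty_range_add_one
  have eR : (PowerSeries.mk fun n => R' (n + 1)) = C 2 * PowerSeries.mk fun n => R (n + 1) := by
    ext n
    rw [coeff_C_mul, coeff_mk, coeff_mk]
    have := twoStateCumulant_add hfree hφXY hψXY (hne n)
    rwa [hR _ (hne n), hR' _ (hne n), Finset.card_range] at this
  have er : (PowerSeries.mk fun n => r' (n + 1)) = C 2 * PowerSeries.mk fun n => r (n + 1) := by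
    ext n
    rw [coeff_C_mul, coeff_mk, coeff_mk]
    have := freeCumulant_add hfree' hψXY (hne n)
    rwa [hr _ (hne n), hr' _ (hne n), Finset.card_range] at this
  have hwS := hasSubst_X_mul (momentSeries ψ (X + Y))
  have hwX := hasSubst_X_mul (momentSeries ψ X)
  rw [eR, subst_mul hwS, C_subst] at hRS
  rw [er, subst_mul hwS, C_subst] at hrS
  set T := PowerSeries.mk fun n => R (n + 1)
  set t := PowerSeries.mk fun n => r (n + 1)
  have expand : ∀ m : PowerSeries ℂ, (T - PowerSeries.X * (1 + C b * T + C c * (t * T))).subst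
      (PowerSeries.X * m) = T.subst (PowerSeries.X * m) - (PowerSeries.X * m) *
        (1 + C b * T.subst (PowerSeries.X * m) +
          C c * (t.subst (PowerSeries.X * m) * T.subst (PowerSeries.X * m))) := by
    intro m
    have hw := hasSubst_X_mul m
    have h1 : (1 : PowerSeries ℂ).subst (PowerSeries.X * m) = 1 := by
      have := C_subst 1 (PowerSeries.X * m)
      rwa [map_one] at this
    rw [subst_sub hw, subst_mul hw, subst_X hw, subst_add hw, subst_add hw, subst_mul hw,
      subst_mul hw, subst_mul hw, C_subst, C_subst, h1]
  -- At `w = z m_S`, insert `M - 1 = 2zM T(w)` and `m - 1 = 2w t(w)` into the equation for `S`; what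
  -- remains is `4zM` times this expression at `w`, and `4zM` is not a zero divisor.
  have hT : T - PowerSeries.X * (1 + C b * T + C c * (t * T)) = 0 := by
    refine eq_zero_of_subst_eq_zero (constantCoeff_momentSeries hψ (X + Y)) ?_
    rw [expand]
    have hM0 : momentSeries φ (X + Y) ≠ 0 := ne_zero_of_constantCoeff_ne_zero (by
      rw [constantCoeff_momentSeries hφ]; exact one_ne_zero)
    have h2 : (C (2 : ℂ) : PowerSeries ℂ) = 2 := map_ofNat C 2
    have h20 : (2 : PowerSeries ℂ) ≠ 0 := by
      rw [← h2]
      exact ne_zero_of_constantCoeff_ne_zero (by simp)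
    refine (mul_eq_zero.1 (?_ : 2 * 2 * PowerSeries.X * momentSeries φ (X + Y) * _ = 0)).resolve_left
      (mul_ne_zero (mul_ne_zero (mul_ne_zero h20 h20) X_ne_zero) hM0)
    rw [h2] at hRS hrS
    rw [map_add, map_mul, h2] at h
    linear_combination h - (2 + C c - momentSeries ψ (X + Y) *
      (2 * C b * PowerSeries.X + C c)) * hRS + 2 * PowerSeries.X * momentSeries φ (X + Y) *
      T.subst (PowerSeries.X * momentSeries ψ (X + Y)) * C c * hrS
  have hTX := expand (momentSeries ψ X)
  rw [hT, ← coe_substAlgHom hwX, map_zero, coe_substAlgHom hwX] at hTX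
  rw [map_add, map_one]
  linear_combination (1 + C c - momentSeries ψ X * (C b * PowerSeries.X + C c)) * hRX -
    PowerSeries.X * momentSeries φ X * C c *
      T.subst (PowerSeries.X * momentSeries ψ X) * hrX -
    PowerSeries.X * momentSeries φ X * hTX

end SummandSeries

/-! ### Solution of the functional equations by continued fractions. -/

section JacobiSolutions

open PowerSeries

theorem constantCoeff_jacobiSeries (β γ : ℕ → ℝ) : constantCoeff (jacobiSeries β γ 0) = 1 := by
  rw [jacobiSeries, ← coeff_zero_eq_constantCoeff_apply, coeff_mk, jacobiCoeff, Complex.ofReal_one]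

/-- The solution of the functional equation of the sum. -/
theorem eq_jacobiSeries_of_sum_eq {β γ : ℕ → ℝ} {b c : ℝ} {M : PowerSeries ℂ}
    (h : C (2 + c : ℂ) * (M - 1) = jacobiSeries β γ 0 *
      (4 * X ^ 2 * M + (C (2 * b : ℂ) * X + C (c : ℂ)) * (M - 1))) :
    M = jacobiSeries (consSeq 0 (consSeq (b + (1 + c / 2) * β 0) fun n => β (n + 1)))
      (consSeq 2 (consSeq ((1 + c / 2) * γ 0) fun n => γ (n + 1))) 0 := by
  have e1 := jacobiSeries_consSeq (consSeq (b + (1 + c / 2) * β 0) fun n => β (n + 1))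
    (consSeq ((1 + c / 2) * γ 0) fun n => γ (n + 1)) 0 2
  have e2 := jacobiSeries_consSeq (fun n => β (n + 1)) (fun n => γ (n + 1))
    (b + (1 + c / 2) * β 0) ((1 + c / 2) * γ 0)
  have e3 := jacobiSeries_continuedFraction β γ
  set m := jacobiSeries β γ 0 with hm
  set N := jacobiSeries (consSeq (b + (1 + c / 2) * β 0) fun n => β (n + 1))
    (consSeq ((1 + c / 2) * γ 0) fun n => γ (n + 1)) 0
  set M' := jacobiSeries (consSeq 0 (consSeq (b + (1 + c / 2) * β 0) fun n => β (n + 1)))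
    (consSeq 2 (consSeq ((1 + c / 2) * γ 0) fun n => γ (n + 1))) 0
  have hk : (C (c : ℂ) : PowerSeries ℂ) = 2 * C ((c : ℂ) / 2) := by
    rw [← map_ofNat (C : ℂ →+* PowerSeries ℂ) 2, ← map_mul, mul_div_cancel₀ _ two_ne_zero]
  rw [Complex.ofReal_zero, map_zero, Complex.ofReal_ofNat, map_ofNat] at e1
  push_cast at e2
  simp only [map_add, map_mul, map_one] at e2
  simp only [map_add, map_mul, map_ofNat] at h
  -- Eliminate the common tail `W`: `1/m = 1 - β₀z - γ₀z²W` turns `1/N = 1 - bz - (1 + c/2)(β₀z +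
  -- γ₀z²W)` into `(1 + c/2)/m - bz - c/2`.
  have hN : N * (2 + C (c : ℂ) - m * (2 * C (b : ℂ) * X + C (c : ℂ))) = 2 * m := by
    rw [hk]
    linear_combination -(2 + 2 * C ((c : ℂ) / 2)) * N * e3 + 2 * m * e2
  -- The coefficient of `M` in the linear equation; its constant term is `2 + c - c = 2`, so the
  -- solution is unique.
  have hU : 2 + C (c : ℂ) - m * (4 * X ^ 2 + 2 * C (b : ℂ) * X + C (c : ℂ)) ≠ 0 := by
    refine ne_zero_of_constantCoeff_ne_zero ?_
    have h2 : constantCoeff (2 : PowerSeries ℂ) = 2 := map_ofNat _ 2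
    simp [hm, constantCoeff_jacobiSeries, h2]
  refine sub_eq_zero.1 ((mul_eq_zero.1 (?_ : (2 + C (c : ℂ) - m * (4 * X ^ 2 +
    2 * C (b : ℂ) * X + C (c : ℂ))) * (M - M') = 0)).resolve_left hU)
  linear_combination h - (2 + C (c : ℂ) - m * (2 * C (b : ℂ) * X + C (c : ℂ))) * e1 -
    2 * X ^ 2 * M' * hN

/-- The solution of the functional equation of a summand. -/
theorem eq_jacobiSeries_of_summand_eq {β γ : ℕ → ℝ} {b c : ℝ} {M : PowerSeries ℂ}
    (h : (M - 1) * (C (1 + c : ℂ) - jacobiSeries β γ 0 * (C (b : ℂ) * X + C (c : ℂ))) =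
      X ^ 2 * jacobiSeries β γ 0 * M) :
    M = jacobiSeries (consSeq 0 (consSeq (b + c * β 0 + β 0) fun n => β (n + 1)))
      (consSeq 1 (consSeq (c * γ 0 + γ 0) fun n => γ (n + 1))) 0 := by
  have e1 := jacobiSeries_consSeq (consSeq (b + c * β 0 + β 0) fun n => β (n + 1))
    (consSeq (c * γ 0 + γ 0) fun n => γ (n + 1)) 0 1
  have e2 := jacobiSeries_consSeq (fun n => β (n + 1)) (fun n => γ (n + 1))
    (b + c * β 0 + β 0) (c * γ 0 + γ 0)
  have e3 := jacobiSeries_continuedFraction β γ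
  set m := jacobiSeries β γ 0 with hm
  set N := jacobiSeries (consSeq (b + c * β 0 + β 0) fun n => β (n + 1))
    (consSeq (c * γ 0 + γ 0) fun n => γ (n + 1)) 0
  set M' := jacobiSeries (consSeq 0 (consSeq (b + c * β 0 + β 0) fun n => β (n + 1)))
    (consSeq 1 (consSeq (c * γ 0 + γ 0) fun n => γ (n + 1))) 0
  rw [Complex.ofReal_zero, map_zero, Complex.ofReal_one, map_one] at e1
  push_cast at e2
  simp only [map_add, map_mul] at e2
  rw [map_add, map_one] at h
  -- As for the sum, elimination of the tail gives `1/N = (1 + c)/m - bz - c`.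
  have hN : N * (1 + C (c : ℂ) - m * (C (b : ℂ) * X + C (c : ℂ))) = m := by
    linear_combination -(1 + C (c : ℂ)) * N * e3 + m * e2
  have hU : 1 + C (c : ℂ) - m * (C (b : ℂ) * X + C (c : ℂ) + X ^ 2) ≠ 0 := by
    refine ne_zero_of_constantCoeff_ne_zero ?_
    simp [hm, constantCoeff_jacobiSeries]
  refine sub_eq_zero.1 ((mul_eq_zero.1 (?_ : (1 + C (c : ℂ) - m * (C (b : ℂ) * X + C (c : ℂ) +
    X ^ 2)) * (M - M') = 0)).resolve_left hU)
  linear_combination h - (1 + C (c : ℂ) - m * (C (b : ℂ) * X + C (c : ℂ))) * e1 -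
    X ^ 2 * M' * hN

end JacobiSolutions

/-! ### From moment series back to measures. -/

section Distributions

variable {A : Type*} [Ring A] [Algebra ℂ A] {φ ψ : A →ₗ[ℂ] ℂ} {x : A}
  {μt μ : MeasureTheory.Measure ℝ}

theorem HasTwoStateDistribution.momentSeries_eq (h : HasTwoStateDistribution φ ψ x μt μ)
    {β γ : ℕ → ℝ} (hJ : HasJacobiParameters μ β γ) :
    momentSeries ψ x = jacobiSeries β γ 0 := by
  have := h.isProbabilityMeasure_right
  ext n
  rw [momentSeries, jacobiSeries, PowerSeries.coeff_mk, PowerSeries.coeff_mk, h.moment_right,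
    hJ.moment_eq]

theorem HasTwoStateDistribution.hasJacobiParameters (h : HasTwoStateDistribution φ ψ x μt μ)
    {β γ : ℕ → ℝ} (hγ : ∀ n, 0 ≤ γ n) (hM : momentSeries φ x = jacobiSeries β γ 0) :
    HasJacobiParameters μt β γ := by
  refine hasJacobiParameters_of_moment_eq h.integrable_left hγ fun n => ?_
  have := congrArg (PowerSeries.coeff n) hM
  rw [momentSeries, jacobiSeries, PowerSeries.coeff_mk, PowerSeries.coeff_mk, h.moment_left] at this
  exact_mod_cast this

end Distributions

theorem consSeq_nonneg {x : ℝ} {f : ℕ → ℝ} (hx : 0 ≤ x) (hf : ∀ n, 0 ≤ f n) (n : ℕ) :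
    0 ≤ consSeq x f n := by
  cases n with
  | zero => exact hx
  | succ n => exact hf n

theorem mainTheorem7 {A : Type*} [Ring A] [StarRing A] [Algebra ℂ A] [StarModule ℂ A]
    (φ ψ : A →ₗ[ℂ] ℂ) (hφ : IsState φ) (hψ : IsState ψ)
    (X Y : A) (hX : IsSelfAdjoint X) (hY : IsSelfAdjoint Y)
    (hfree : IsTwoStateFree φ ψ X Y)
    (hφXY : ∀ n : ℕ, φ (X ^ n) = φ (Y ^ n)) (hψXY : ∀ n : ℕ, ψ (X ^ n) = ψ (Y ^ n))
    (hmean : φ X = 0) (hvar : φ (X ^ 2) = 1)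
    (b C c : ℝ) (hc : -2 < c)
    (hreg : ∀ n : ℕ, φ ((X - Y) ^ 2 * (X + Y) ^ n) =
      (C : ℂ) * φ (((4 : ℂ) • (1 : A) + ((2 * b : ℝ) : ℂ) • (X + Y) + (c : ℂ) • (X + Y) ^ 2) *
        (X + Y) ^ n)) :
    (∀ μtS μS : MeasureTheory.Measure ℝ, HasTwoStateDistribution φ ψ (X + Y) μtS μS →
      ∀ β γ : ℕ → ℝ, HasJacobiParameters μS β γ →
        HasJacobiParameters μtS
          (consSeq 0 (consSeq (b + (1 + c / 2) * β 0) fun n => β (n + 1)))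
          (consSeq 2 (consSeq ((1 + c / 2) * γ 0) fun n => γ (n + 1)))) ∧
    (IsFreePair ψ X Y → -1 ≤ c →
      ∀ μt μ : MeasureTheory.Measure ℝ, HasTwoStateDistribution φ ψ X μt μ →
        ∀ β₀ γ₀ b' c' : ℝ, IsFreeMeixner μ β₀ γ₀ b' c' →
          HasJacobiParameters μt
            (consSeq 0 (consSeq ((b + c * β₀) + β₀) fun _ => b' + β₀))
            (consSeq 1 (consSeq (c * γ₀ + γ₀) fun _ => c' + γ₀)) ∧
          (0 < γ₀ → IsTwoStateFreeMeixner μt μ)) := by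
  have hsum := momentSeries_add_eq hφ.map_one hψ.map_one hfree hφXY hψXY hmean hvar b C c hreg
  constructor
  · intro μtS μS hS β γ hJ
    rw [hS.momentSeries_eq hJ] at hsum
    refine hS.hasJacobiParameters (consSeq_nonneg (by norm_num) (consSeq_nonneg ?_ ?_))
      (eq_jacobiSeries_of_sum_eq hsum)
    · exact mul_nonneg (by linarith) (hJ.nonneg 0)
    · exact fun n => hJ.nonneg (n + 1)
  · intro hfree' hc' μt μ hμ β₀ γ₀ b' c' hF
    have hX := momentSeries_summand_eq hφ.map_one hψ.map_one hfree hfree' hφXY hψXY hsum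
    rw [hμ.momentSeries_eq hF.jacobi] at hX
    have hcγ : 0 ≤ c * γ₀ + γ₀ := by nlinarith [hF.gamma_nonneg]
    have hJ : HasJacobiParameters μt
        (consSeq 0 (consSeq ((b + c * β₀) + β₀) fun _ => b' + β₀))
        (consSeq 1 (consSeq (c * γ₀ + γ₀) fun _ => c' + γ₀)) :=
      hμ.hasJacobiParameters (consSeq_nonneg zero_le_one (consSeq_nonneg hcγ fun _ => hF.add_nonneg))
        (eq_jacobiSeries_of_summand_eq hX)
    -- In the two-state Meixner form the second-row parameters are `b̃ = b + cβ₀` and `c̃ = cγ₀`; `c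
    -- ≥ -1` is what makes `c̃ + γ₀` nonnegative.
    exact ⟨hJ, fun hγ => ⟨hμ.isProbabilityMeasure_left, hμ.isProbabilityMeasure_right,
      0, 1, b + c * β₀, c * γ₀, β₀, γ₀, b', c', hγ, zero_le_one, hF.add_nonneg, hcγ, hJ,
      hF.jacobi⟩⟩
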